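/- Let $n,m\in\mathbb N$ and consider the discrete-time plant $$x(t+1)=Ax(t)+Bu(t),\qquad x(t)\in\mathbb R^n,\ u(t)\in\mathbb R^m,\ t=0,1,2,\dots,$$ and the reference model $x_m(t+1)=A_mx_m(t)+B_mr(t)$, with arbitrary initial states. Assume: (A1) all eigenvalues of $A_m$ lie inside the unit circle of $\mathbb C$; (A2) $r(t)\in\mathbb R^m$ is bounded; (A3), (A4) there are $K_1^*\in\mathbb R^{n\times m}$ and a nonsingular diagonal matrix $K_2^*=\mathrm{diag}\{k_{21}^*,\dots,k_{2m}^*\}$ with $A+BK_1^{*T}=A_m$ and $BK_2^*=B_m$, and the signs $\sigma_j=\mathrm{sign}[k_{2j}^*]$ are known; (A5) bounds $k_{2j}^b\ge|k_{2j}^*|$, $j=1,\dots,m$, are known. The adaptive controller is as follows. The parameter estimates are $\Theta_1(t)\in\mathbb R^{n\times m}$ and $\Theta_2(t)=\mathrm{diag}\{\theta_{21}(t),\dots,\theta_{2m}(t)\}$; $\theta_j(t)\in\mathbb R^{n+1}$ consists of the $j$-th column of $\Theta_1(t)$ followed by $\theta_{2j}(t)$, and $\theta=(\theta_1^T,\dots,\theta_m^T)^T\in\mathbb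 R^{m(n+1)}$. The control input and the state estimator (with arbitrary $\hat x(0)$) are $$u(t)=\Theta_2^{-1}(t)\big(\Theta_1^T(t)x(t)+r(t)\big),\qquad \hat x(t+1)=A_m\hat x(t)+B_m\big(\Theta_2(t)u(t)-\Theta_1^T(t)x(t)\big).$$ Let $w_{ij}(z)$ be the entries of $W_m(z)=(zI-A_m)^{-1}B_m$, and let $w_{ij}(z)[v](t)$ denote the output at time $t$ of the system $w_{ij}(z)$ driven by the signal $v$, with zero initial condition. Put $\omega_j(t)=[-x^T(t),u_j(t)]^T$, $e_x=\hat x-x$ and, for $i=1,\dots,n$, $j=1,\dots,m$, $$\zeta_{ij}(t)=w_{ij}(z)[\omega_j](t),\quad \xi_{ij}(t)=\theta_j^T(t)\zeta_{ij}(t)-w_{ij}(z)[\theta_j^T\omega_j](t),\quad \epsilon_i(t)=e_{xi}(t)+\sum_{j=1}^m\xi_{ij}(t),$$ $$\zeta_i=[\zeta_{i1}^T,\dots,\zeta_{im}^T]^T,\quad Z=[\zeta_1,\dots,\zeta_n]\in\mathbb R^{m(n+1)\times n},\quad \epsilon=[\epsilon_1,\dots,\epsilon_n]^T,\quad N(t)=\kappa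 I+Z^T(t)P(t-1)Z(t).$$ The least-squares adaptive law is $$\bar\theta(t+1)=\theta(t)-P(t-1)Z(t)N^{-1}(t)\epsilon(t),\qquad P(t)=P(t-1)-P(t-1)Z(t)N^{-1}(t)Z^T(t)P(t-1),$$ with $\kappa>0$ and $P(-1)=P_0=P_0^T>0$. Parameter projection takes $\theta(t+1)$ to be the point of $$S=\{\vartheta\in\mathbb R^{m(n+1)}:\ \sigma_j\vartheta_{2j}\ge 1/k_{2j}^b,\ j=1,\dots,m\}$$ ($\vartheta_{2j}$ being the entry of $\vartheta$ in the place of $\theta_{2j}$) that minimizes $(\vartheta-\bar\theta(t+1))^TP^{-1}(t)(\vartheta-\bar\theta(t+1))$ over $\vartheta\in S$; so $\theta(t+1)=\bar\theta(t+1)$ whenever $\bar\theta(t+1)\in S$. The initial estimate $\theta(0)=\theta_0$ is chosen in $S$. Then $\Theta_2(t)$ is nonsingular for every $t\ge 0$; all closed-loop signals, namely $x$, $x_m$, $\hat x$, $e_x$, $u$, $\theta$, $\Theta_2^{-1}$, $\omega_j$, $Z$, $\xi_{ij}$, $\epsilon$, $P$, $N$, $N^{-1}$ and $\bar\theta$,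 are bounded; and $$\lim_{t\to\infty}\big(x(t)-x_m(t)\big)=0.$$ -/

import Mathlib

open Matrix Filter Topology

namespace MRAC

/-- Boundedness of a discrete-time signal with finitely many real components. -/
def BoundedSignal {ι : Type} (s : ℕ → ι → ℝ) : Prop :=
  ∃ C : ℝ, ∀ t i, |s t i| ≤ C

/-- Boundedness of a matrix-valued discrete-time signal. -/
def BoundedMatrixSignal {ι ι' : Type} (S : ℕ → Matrix ι ι' ℝ) : Prop :=
  ∃ C : ℝ, ∀ t i j, |S t i j| ≤ C

/-- All (complex) eigenvalues of the real matrix `M` lie inside the unit circle. -/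
def IsSchurStable {n : ℕ} (M : Matrix (Fin n) (Fin n) ℝ) : Prop :=
  ∀ z ∈ spectrum ℂ (M.map (algebraMap ℝ ℂ)), ‖z‖ < 1

/-- The output `y = W_m(z)[v]` of the transfer matrix `W_m(z) = (zI - A_m)⁻¹ B_m`:
the signal with `(zI - A_m)[y] = B_m v`, i.e. `y(t+1) = A_m y(t) + B_m v(t)`, and `y(0) = 0`. -/
def transferMatrix {n m : ℕ} (Am : Matrix (Fin n) (Fin n) ℝ) (Bm : Matrix (Fin n) (Fin m) ℝ)
    (v : ℕ → Fin m → ℝ) : ℕ → Fin n → ℝ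
  | 0 => 0
  | t + 1 => Am *ᵥ transferMatrix Am Bm v t + Bm *ᵥ v t

/-- The output `w_ij(z)[v]` of the `(i, j)` entry of `W_m(z)`, for a scalar signal `v`: feed `v`
into the `j`-th input channel (and zero into the others) and read the `i`-th output. -/
def transferEntry {n m : ℕ} (Am : Matrix (Fin n) (Fin n) ℝ) (Bm : Matrix (Fin n) (Fin m) ℝ)
    (i : Fin n) (j : Fin m) (v : ℕ → ℝ) (t : ℕ) : ℝ :=
  transferMatrix Am Bm (fun τ => Pi.single j (v τ)) t i

/-- Index set of one parameter column `θ_j ∈ ℝ^(n+1)`: `inl k` is the `k`-th entry of the `j`-th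
column of `Θ₁`, and `inr ()` is the `j`-th diagonal entry `θ_2j` of `Θ₂`. -/
abbrev ColIdx (n : ℕ) : Type := Fin n ⊕ Unit

/-- Index set of the stacked parameter vector `θ = (θ_1, …, θ_m) ∈ ℝ^(m(n+1))`. -/
abbrev ParamIdx (n m : ℕ) : Type := Fin m × ColIdx n

/-- The parameter vectors allowed by the known signs `σ_j` and the known bounds `kb_j`:
`θ_2j` has the sign `σ_j` and `|θ_2j| ≥ 1 / kb_j`. -/
def admissible {n m : ℕ} (σ : Fin m → SignType) (kb : Fin m → ℝ) : Set (ParamIdx n m → ℝ) :=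
  {ϑ | ∀ j, 1 / kb j ≤ (σ j : ℝ) * ϑ (j, Sum.inr ())}

/-- `p` is the projection of `y` onto `S` in the metric given by the quadratic form of `W`. -/
def IsProjection {ι : Type} [Fintype ι] (W : Matrix ι ι ℝ) (S : Set (ι → ℝ))
    (y p : ι → ℝ) : Prop :=
  p ∈ S ∧ ∀ q ∈ S, (p - y) ⬝ᵥ (W *ᵥ (p - y)) ≤ (q - y) ⬝ᵥ (W *ᵥ (q - y))

/-- The signals generated by the adaptive control system: plant state, reference state, estimated
state, control input, parameter estimate and the gain matrix, where `Pprev t` is `P(t - 1)`. -/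
structure Signals (n m : ℕ) where
  x : ℕ → Fin n → ℝ
  xm : ℕ → Fin n → ℝ
  xhat : ℕ → Fin n → ℝ
  u : ℕ → Fin m → ℝ
  θ : ℕ → ParamIdx n m → ℝ
  Pprev : ℕ → Matrix (ParamIdx n m) (ParamIdx n m) ℝ

namespace Signals

variable {n m : ℕ} (s : Signals n m)

/-- `Θ₁(t) ∈ ℝ^(n×m)`. -/
def Θ₁ (t : ℕ) : Matrix (Fin n) (Fin m) ℝ := Matrix.of fun k j => s.θ t (j, Sum.inl k)

/-- `Θ₂(t) = diag(θ_21(t), …, θ_2m(t))`. -/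
def Θ₂ (t : ℕ) : Matrix (Fin m) (Fin m) ℝ := Matrix.diagonal fun j => s.θ t (j, Sum.inr ())

/-- The state estimator error `e_x = xhat - x`. -/
def ex (t : ℕ) : Fin n → ℝ := s.xhat t - s.x t

/-- `ω_j(t) = (-x(t), u_j(t)) ∈ ℝ^(n+1)`, for all `j` at once. -/
def ω (t : ℕ) : ParamIdx n m → ℝ :=
  fun p => Sum.elim (fun k => -s.x t k) (fun _ => s.u t p.1) p.2

variable (Am : Matrix (Fin n) (Fin n) ℝ) (Bm : Matrix (Fin n) (Fin m) ℝ)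

/-- `ζ_ij(t) = w_ij(z)[ω_j](t) ∈ ℝ^(n+1)`. -/
def ζ (i : Fin n) (j : Fin m) (t : ℕ) : ColIdx n → ℝ :=
  fun k => transferEntry Am Bm i j (fun τ => s.ω τ (j, k)) t

/-- `ξ_ij(t) = θ_jᵀ(t) ζ_ij(t) - w_ij(z)[θ_jᵀ ω_j](t)`. -/
def ξ (i : Fin n) (j : Fin m) (t : ℕ) : ℝ :=
  (∑ k, s.θ t (j, k) * s.ζ Am Bm i j t k)
    - transferEntry Am Bm i j (fun τ => ∑ k, s.θ τ (j, k) * s.ω τ (j, k)) t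

/-- The estimation error `ε_i = e_xi + ∑_j ξ_ij`. -/
def ε (t : ℕ) : Fin n → ℝ := fun i => s.ex t i + ∑ j, s.ξ Am Bm i j t

/-- `Z = [ζ_1, …, ζ_n]` with columns `ζ_i = (ζ_i1, …, ζ_im) ∈ ℝ^(m(n+1))`. -/
def Z (t : ℕ) : Matrix (ParamIdx n m) (Fin n) ℝ := Matrix.of fun p i => s.ζ Am Bm i p.1 t p.2

/-- `N(t) = κ I + Zᵀ(t) P(t-1) Z(t)`. -/
def N (κ : ℝ) (t : ℕ) : Matrix (Fin n) (Fin n) ℝ :=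
  κ • (1 : Matrix (Fin n) (Fin n) ℝ) + (s.Z Am Bm t)ᵀ * s.Pprev t * s.Z Am Bm t

/-- The least-squares update `θ(t) - P(t-1) Z(t) N⁻¹(t) ε(t)`, before parameter projection. -/
noncomputable def lsUpdate (κ : ℝ) (t : ℕ) : ParamIdx n m → ℝ :=
  s.θ t - (s.Pprev t * s.Z Am Bm t * (s.N Am Bm κ t)⁻¹) *ᵥ s.ε Am Bm t

end Signals

/-- The closed-loop adaptive control system. The initial states `x(0)`, `xm(0)`, `xhat(0)` are
arbitrary. The plant matrices `A`, `B` enter only through the plant equation; all the other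
equations use only quantities known to the designer. -/
structure IsClosedLoop {n m : ℕ} (A : Matrix (Fin n) (Fin n) ℝ) (B : Matrix (Fin n) (Fin m) ℝ)
    (Am : Matrix (Fin n) (Fin n) ℝ) (Bm : Matrix (Fin n) (Fin m) ℝ) (r : ℕ → Fin m → ℝ)
    (σ : Fin m → SignType) (kb : Fin m → ℝ) (κ : ℝ)
    (P₀ : Matrix (ParamIdx n m) (ParamIdx n m) ℝ) (θ₀ : ParamIdx n m → ℝ)
    (s : Signals n m) : Prop where
  /-- plant -/
  plant : ∀ t, s.x (t + 1) = A *ᵥ s.x t + B *ᵥ s.u t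
  /-- reference model -/
  reference : ∀ t, s.xm (t + 1) = Am *ᵥ s.xm t + Bm *ᵥ r t
  /-- state estimator -/
  estimator : ∀ t, s.xhat (t + 1) =
    Am *ᵥ s.xhat t + Bm *ᵥ (s.Θ₂ t *ᵥ s.u t - (s.Θ₁ t)ᵀ *ᵥ s.x t)
  /-- control law -/
  control : ∀ t, s.u t = (s.Θ₂ t)⁻¹ *ᵥ ((s.Θ₁ t)ᵀ *ᵥ s.x t + r t)
  /-- initial gain matrix `P(-1) = P₀` -/
  gain_init : s.Pprev 0 = P₀
  /-- `P(t) = P(t-1) - P(t-1) Z(t) N⁻¹(t) Zᵀ(t) P(t-1)` -/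
  gain_update : ∀ t, s.Pprev (t + 1) = s.Pprev t
    - s.Pprev t * s.Z Am Bm t * (s.N Am Bm κ t)⁻¹ * (s.Z Am Bm t)ᵀ * s.Pprev t
  /-- initial parameter estimate -/
  param_init : s.θ 0 = θ₀
  /-- least-squares adaptive law with parameter projection: `θ(t+1)` is the least-squares update,
  projected onto the admissible set in the metric of `P⁻¹(t)`, the information matrix of the
  least-squares cost (so `θ(t+1)` is the least-squares update itself if that is admissible) -/
  param_update : ∀ t, IsProjection (s.Pprev (t + 1))⁻¹ (admissible σ kb)
    (s.lsUpdate Am Bm κ t) (s.θ (t + 1))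

end MRAC

namespace MRAC

/-! The control law makes `θ_jᵀ ω_j = r_j` hold exactly, so `xhat` obeys the reference model and
`xhat - xm` decays regardless of adaptation. Everything therefore reduces to `e_x → 0`.

With the ideal parameter `θ*`, matching turns the plant into `x⁺ = A_m x + B_m (θ*_jᵀ ω_j)_j`. Since
constant parameters commute with the filter `W_m`, `ε = Zᵀ(θ - θ*) + η`, where `η` is a free
response of `A_m` and hence square summable (`disturbance_succ`). The Lyapunov function `V = (θ -
θ*)ᵀ P(t-1)⁻¹ (θ - θ*)` then drops at each step by `εᵀN⁻¹ε` plus the squared projection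
displacement, up to `|η|²/κ`. This combines `quadForm_update` with `IsProjection.pythagoras`, which
apply together because the projection uses the metric `P(t)⁻¹` of the next `V`. Thus `θ` is bounded,
while `εᵀN⁻¹ε` and the increments of `θ` tend to zero (`adaptation`).

To pass from normalized to actual errors, the swapping error `∑_j ξ_ij` is shown to be a stable
recursion driven by `Zᵀ` times the increments of `θ` (`swappingError_succ`). `W_m` is strictly
causal and `u` grows at most linearly with `x`, so `e_x(t)` is at most a vanishing factor times one
plus the past maximum of `x` (`exists_vanishing_gain`). As `x = xhat - e_x` with `xhat` bounded, the
small-gain lemma `bounded_of_vanishing_gain` bounds `x`, and then `e_x → 0`. -/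

/-- A norm on `ℝⁿ`, equivalent to the sup norm, for which `M` is a strict contraction. -/
structure ContractingNorm {n : ℕ} (M : Matrix (Fin n) (Fin n) ℝ) where
  rate : ℝ
  bound : ℝ
  toFun : (Fin n → ℝ) → ℝ
  rate_nonneg : 0 ≤ rate
  rate_lt_one : rate < 1
  bound_nonneg : 0 ≤ bound
  norm_le : ∀ v, ‖v‖ ≤ toFun v
  le_bound : ∀ v, toFun v ≤ bound * ‖v‖
  add_le : ∀ v w, toFun (v + w) ≤ toFun v + toFun w
  mulVec_le : ∀ v, toFun (M *ᵥ v) ≤ rate * toFun v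

/-! ### Norms adapted to a Schur stable matrix -/

section Stability

variable {n : ℕ} {M : Matrix (Fin n) (Fin n) ℝ}

open scoped Matrix.Norms.Operator in
/-- Some power of a Schur stable matrix is a contraction, with geometric rate. -/
theorem IsSchurStable.exists_pow_mulVec_le (hM : IsSchurStable M) :
    ∃ (p : ℕ) (q : ℝ), 0 < p ∧ 0 < q ∧ q < 1 ∧ ∀ v, ‖(M ^ p) *ᵥ v‖ ≤ q ^ p * ‖v‖ := by
  -- For `n = 0` the matrix algebra is trivial, so it is treated apart from the spectral argument.
  rcases Nat.eq_zero_or_pos n with rfl | hn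
  · exact ⟨1, 1 / 2, one_pos, by norm_num, by norm_num, fun v => by
      rw [Subsingleton.elim (M ^ 1 *ᵥ v) 0, norm_zero]; positivity⟩
  have : Nonempty (Fin n) := ⟨⟨0, hn⟩⟩
  set a : Matrix (Fin n) (Fin n) ℂ := M.map (algebraMap ℝ ℂ) with ha
  have hρ : spectralRadius ℂ a < ((1 : NNReal) : ENNReal) :=
    spectrum.spectralRadius_lt_of_forall_lt a fun z hz => hM z hz
  obtain ⟨q, hq, hq1⟩ := ENNReal.lt_iff_exists_nnreal_btwn.1 hρ
  -- Gelfand's formula, with `q` strictly between the spectral radius and 1.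
  have hev := (spectrum.pow_nnnorm_pow_one_div_tendsto_nhds_spectralRadius a).eventually_lt_const hq
  obtain ⟨p, hp, hp0⟩ := (hev.and (eventually_gt_atTop 0)).exists
  have hpR : (0 : ℝ) < p := by exact_mod_cast hp0
  have hlt : ‖a ^ p‖₊ < q ^ p := by
    have h := (ENNReal.rpow_lt_rpow_iff hpR).2 hp
    rw [← ENNReal.rpow_mul, one_div, inv_mul_cancel₀ hpR.ne', ENNReal.rpow_one,
      ENNReal.rpow_natCast] at h
    exact_mod_cast h
  refine ⟨p, q, hp0, ?_, by exact_mod_cast hq1, fun v => ?_⟩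
  · exact_mod_cast lt_of_le_of_lt (zero_le) hq
  · have hc : ∀ w : Fin n → ℝ, ‖(algebraMap ℝ ℂ) ∘ w‖ = ‖w‖ := fun w => by
      simp [Pi.norm_def, Function.comp_def]
    have hmap : (algebraMap ℝ ℂ) ∘ (M ^ p *ᵥ v) = a ^ p *ᵥ ((algebraMap ℝ ℂ) ∘ v) := by
      funext i
      have := RingHom.map_mulVec (algebraMap ℝ ℂ) (M ^ p) v i
      rwa [Matrix.map_pow] at this
    rw [← hc, hmap, ← hc v]
    refine (Matrix.linfty_opNorm_mulVec _ _).trans ?_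
    have : ‖a ^ p‖ ≤ (q : ℝ) ^ p := by exact_mod_cast hlt.le
    gcongr

-- The norm is `∑_{k<p} q⁻ᵏ ‖Mᵏ v‖`. Applying `M` shifts the sum by one index at the price of a
-- factor `q`, and the new top term `q⁻ᵖ ‖Mᵖ v‖` is at most the lost term `‖v‖`.
open scoped Matrix.Norms.Operator in
theorem IsSchurStable.nonempty_contractingNorm (hM : IsSchurStable M) :
    Nonempty (ContractingNorm M) := by
  obtain ⟨p, q, hp, hq, hq1, h⟩ := hM.exists_pow_mulVec_le
  refine ⟨{
    rate := q
    bound := ∑ k ∈ Finset.range p, (q ^ k)⁻¹ * ‖M ^ k‖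
    toFun := fun v => ∑ k ∈ Finset.range p, (q ^ k)⁻¹ * ‖M ^ k *ᵥ v‖
    rate_nonneg := hq.le
    rate_lt_one := hq1
    bound_nonneg := by positivity
    norm_le := fun v => ?_
    le_bound := fun v => ?_
    add_le := fun v w => ?_
    mulVec_le := fun v => ?_ }⟩
  · have := Finset.single_le_sum (f := fun k => (q ^ k)⁻¹ * ‖M ^ k *ᵥ v‖)
      (fun k _ => by positivity) (Finset.mem_range.2 hp)
    simpa using this
  · rw [Finset.sum_mul]
    refine Finset.sum_le_sum fun k _ => ?_
    rw [mul_assoc]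
    gcongr
    exact Matrix.linfty_opNorm_mulVec _ _
  · rw [← Finset.sum_add_distrib]
    refine Finset.sum_le_sum fun k _ => ?_
    rw [← mul_add, mulVec_add]
    gcongr
    exact norm_add_le _ _
  · have h1 : ∑ k ∈ Finset.range p, (q ^ k)⁻¹ * ‖M ^ k *ᵥ (M *ᵥ v)‖
        = q * ∑ k ∈ Finset.range p, (q ^ (k + 1))⁻¹ * ‖M ^ (k + 1) *ᵥ v‖ := by
      rw [Finset.mul_sum]
      refine Finset.sum_congr rfl fun k _ => ?_
      rw [mulVec_mulVec, ← pow_succ, ← mul_assoc, pow_succ q, mul_inv, mul_left_comm,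
        mul_inv_cancel₀ hq.ne', mul_one]
    have h2 := Finset.sum_range_succ (fun k => (q ^ k)⁻¹ * ‖M ^ k *ᵥ v‖) p
    rw [Finset.sum_range_succ'] at h2
    have h3 : (q ^ p)⁻¹ * ‖M ^ p *ᵥ v‖ ≤ ‖v‖ := by
      rw [inv_mul_le_iff₀ (by positivity)]
      exact h v
    simp only [pow_zero, inv_one, one_mul, one_mulVec] at h2
    rw [h1]
    exact mul_le_mul_of_nonneg_left (by linarith) hq.le

end Stability

/-! ### Scalar recursions and descent inequalities -/

section Scalar

/-- A stable scalar recursion driven by a bounded input stays bounded. -/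
theorem le_of_recursion_le {b : ℕ → ℝ} {q f : ℝ} (hq : 0 ≤ q) {t : ℕ}
    (hb : ∀ τ < t, b (τ + 1) ≤ q * b τ + f) {C : ℝ} (h0 : b 0 ≤ C) (hC : f ≤ (1 - q) * C) :
    ∀ τ ≤ t, b τ ≤ C := by
  intro τ
  induction τ with
  | zero => exact fun _ => h0
  | succ τ ih =>
    intro hτ
    have := mul_le_mul_of_nonneg_left (ih (by omega)) hq
    linarith [hb τ hτ]

/-- A stable scalar recursion driven by an input tending to zero tends to zero. -/
theorem tendsto_zero_of_recursion_le {b f : ℕ → ℝ} {q : ℝ} (hq : 0 ≤ q) (hq1 : q < 1)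
    (hb0 : ∀ t, 0 ≤ b t) (hb : ∀ t, b (t + 1) ≤ q * b t + f t) (hf : Tendsto f atTop (𝓝 0)) :
    Tendsto b atTop (𝓝 0) := by
  rw [Metric.tendsto_atTop]
  intro e he
  -- A constant input `(1 - q) * (e / 2)` has equilibrium `e / 2`; the other half of `e` absorbs the
  -- decaying transient.
  have hpos : 0 < (1 - q) * (e / 2) := mul_pos (by linarith) (by linarith)
  obtain ⟨T, hT⟩ := eventually_atTop.1 (hf.eventually_le_const hpos)
  have hdecay : ∀ k, b (T + k) ≤ q ^ k * b T + e / 2 := by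
    intro k
    induction k with
    | zero => simp; linarith
    | succ k ih =>
      have h1 := hb (T + k)
      have h2 := hT (T + k) (by omega)
      have h3 := mul_le_mul_of_nonneg_left ih hq
      rw [← add_assoc, pow_succ]
      nlinarith
  have hlim : Tendsto (fun k => q ^ k * b T) atTop (𝓝 0) := by
    simpa using (tendsto_pow_atTop_nhds_zero_of_lt_one hq hq1).mul_const (b T)
  obtain ⟨K, hK⟩ := eventually_atTop.1 (hlim.eventually_lt_const (half_pos he))
  refine ⟨T + K, fun t ht => ?_⟩
  obtain ⟨k, rfl⟩ := Nat.exists_eq_add_of_le (show T ≤ t by omega)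
  rw [Real.dist_eq, sub_zero, abs_of_nonneg (hb0 _)]
  linarith [hdecay k, hK k (by omega)]

/-- A small-gain argument: if the loop gain tends to zero, then the signal is bounded. -/
theorem bounded_of_vanishing_gain {b γ : ℕ → ℝ} {C : ℝ} (hγ : Tendsto γ atTop (𝓝 0))
    (h : ∀ t R, 0 ≤ R → (∀ τ < t, b τ ≤ R) → b t ≤ C + γ t * (1 + R)) :
    ∃ R, 0 ≤ R ∧ ∀ t, b t ≤ R := by
  obtain ⟨T, hT⟩ := eventually_atTop.1 (hγ.eventually_le_const (half_pos one_pos))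
  obtain ⟨D, hD⟩ := ((Finset.range T).image b).bddAbove
  -- Once the gain is at most `1/2`, the bound `C + (1 + R)/2` is at most `R` as soon as `R ≥ 2C +
  -- 1`; `D` covers the finitely many earlier times.
  refine ⟨max (max 0 D) (2 * C + 1), le_max_of_le_left (le_max_left _ _), fun t => ?_⟩
  induction t using Nat.strong_induction_on with
  | _ t ih =>
    rcases lt_or_ge t T with ht | ht
    · refine (hD ?_).trans (le_max_of_le_left (le_max_right _ _))
      simpa using ⟨t, ht, rfl⟩
    · set R := max (max 0 D) (2 * C + 1)
      have hR : 0 ≤ R := le_max_of_le_left (le_max_left _ _)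
      have hRC : 2 * C + 1 ≤ R := le_max_right _ _
      have h1 := h t R hR ih
      have h2 := mul_le_mul_of_nonneg_right (hT t ht) (show 0 ≤ 1 + R by linarith)
      linarith

/-- If `V ≥ 0` decreases by `f ≥ 0` up to a summable perturbation, then `V` is bounded and `f`
tends to zero. -/
theorem bounded_and_tendsto_zero_of_descent {V f h : ℕ → ℝ} (hV : ∀ t, 0 ≤ V t)
    (hf : ∀ t, 0 ≤ f t) (hh : ∀ t, 0 ≤ h t) (hsum : Summable h)
    (hstep : ∀ t, V (t + 1) + f t ≤ V t + h t) :
    (∃ C, ∀ t, V t ≤ C) ∧ Tendsto f atTop (𝓝 0) := by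
  have key : ∀ t, V t + ∑ τ ∈ Finset.range t, f τ ≤ V 0 + ∑' τ, h τ := by
    intro t
    have : V t + ∑ τ ∈ Finset.range t, f τ ≤ V 0 + ∑ τ ∈ Finset.range t, h τ := by
      induction t with
      | zero => simp
      | succ t ih => rw [Finset.sum_range_succ, Finset.sum_range_succ]; linarith [hstep t]
    linarith [hsum.sum_le_tsum (Finset.range t) fun τ _ => hh τ]
  refine ⟨⟨V 0 + ∑' τ, h τ, fun t => ?_⟩, ?_⟩
  · linarith [key t, Finset.sum_nonneg fun τ (_ : τ ∈ Finset.range t) => hf τ]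
  · exact (summable_of_sum_range_le (c := V 0 + ∑' τ, h τ) hf fun t => by
      linarith [key t, hV t]).tendsto_atTop_zero

end Scalar

/-! ### Vector recursions driven by a stable matrix -/

namespace ContractingNorm

variable {n : ℕ} {M : Matrix (Fin n) (Fin n) ℝ}

theorem nonneg (N : ContractingNorm M) (v : Fin n → ℝ) : 0 ≤ N.toFun v := (norm_nonneg v).trans (N.norm_le v)

theorem step_le (N : ContractingNorm M) (v f : Fin n → ℝ) :
    N.toFun (M *ᵥ v + f) ≤ N.rate * N.toFun v + N.bound * ‖f‖ :=
  (N.add_le _ _).trans (add_le_add (N.mulVec_le v) (N.le_bound f))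

theorem tendsto_zero (N : ContractingNorm M) {y f : ℕ → Fin n → ℝ} (hy : ∀ t, y (t + 1) = M *ᵥ y t + f t)
    (hf : Tendsto f atTop (𝓝 0)) : Tendsto y atTop (𝓝 0) := by
  have h := tendsto_zero_of_recursion_le (b := fun t => N.toFun (y t)) N.rate_nonneg N.rate_lt_one
    (fun t => N.nonneg _) (fun t => by rw [hy]; exact N.step_le _ _)
    (by simpa using hf.norm.const_mul N.bound)
  exact squeeze_zero_norm (fun t => N.norm_le _) h

/-- The free response of a stable system is square summable. -/
theorem summable_sq (N : ContractingNorm M) {y : ℕ → Fin n → ℝ} (hy : ∀ t, y (t + 1) = M *ᵥ y t) :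
    Summable fun t => ‖y t‖ ^ 2 := by
  have h : ∀ t, N.toFun (y t) ≤ N.rate ^ t * N.toFun (y 0) := by
    intro t
    induction t with
    | zero => simp
    | succ t ih =>
      rw [hy, pow_succ', mul_assoc]
      exact (N.mulVec_le _).trans (mul_le_mul_of_nonneg_left ih N.rate_nonneg)
  have hg : Summable fun t : ℕ => (N.rate ^ 2) ^ t * N.toFun (y 0) ^ 2 :=
    (summable_geometric_of_lt_one (sq_nonneg _)
      (pow_lt_one₀ N.rate_nonneg N.rate_lt_one two_ne_zero)).mul_right _
  refine hg.of_nonneg_of_le (fun t => sq_nonneg _) fun t => ?_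
  rw [← pow_mul, mul_comm 2 t, pow_mul, ← mul_pow]
  exact pow_le_pow_left₀ (norm_nonneg _) ((N.norm_le _).trans (h t)) 2

/-- The gain from the input `f` (bounded by `F` up to time `t`) to the state. -/
theorem norm_le_of_input_le (N : ContractingNorm M) {y f : ℕ → Fin n → ℝ} {t : ℕ}
    (hy : ∀ τ < t, y (τ + 1) = M *ᵥ y τ + f τ) {F : ℝ} (hF0 : 0 ≤ F) (hF : ∀ τ < t, ‖f τ‖ ≤ F) :
    ∀ τ ≤ t, ‖y τ‖ ≤ N.toFun (y 0) + N.bound * F / (1 - N.rate) := by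
  have h1 : 0 < 1 - N.rate := by linarith [N.rate_lt_one]
  have h2 := N.nonneg (y 0)
  have h3 := N.bound_nonneg
  have h := le_of_recursion_le (b := fun t => N.toFun (y t)) (f := N.bound * F) N.rate_nonneg
    (t := t) (C := N.toFun (y 0) + N.bound * F / (1 - N.rate))
    (fun τ hτ => by
      rw [hy τ hτ]
      exact (N.step_le _ _).trans (by have := hF τ hτ; gcongr))
    (by simp only [le_add_iff_nonneg_right]; positivity)
    (by rw [mul_add, mul_div_cancel₀ _ h1.ne']; linarith [mul_nonneg h1.le h2])
  exact fun τ hτ => (N.norm_le _).trans (h τ hτ)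

end ContractingNorm

/-! ### Weighted projections and least-squares identities -/

section LeastSquares

variable {ι κι : Type} [Fintype ι] [Fintype κι]

theorem dotProduct_mulVec_symm {W : Matrix ι ι ℝ} (hW : W.PosSemidef) (v w : ι → ℝ) :
    v ⬝ᵥ W *ᵥ w = w ⬝ᵥ W *ᵥ v := by
  have h : Wᵀ = W := by simpa [IsHermitian, conjTranspose_eq_transpose_of_trivial] using hW.1
  rw [dotProduct_mulVec, dotProduct_comm, ← mulVec_transpose, h]

theorem quadForm_nonneg {W : Matrix ι ι ℝ} (hW : W.PosSemidef) (v : ι → ℝ) :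
    0 ≤ v ⬝ᵥ W *ᵥ v := by
  simpa using hW.dotProduct_mulVec_nonneg v

theorem posSemidef_transpose_mul_mul {P : Matrix ι ι ℝ} (hP : P.PosSemidef) (Z : Matrix ι κι ℝ) :
    (Zᵀ * P * Z).PosSemidef := by
  simpa [conjTranspose_eq_transpose_of_trivial] using hP.conjTranspose_mul_mul_same Z

/-- The Pythagorean inequality for the projection onto a convex set. -/
theorem IsProjection.pythagoras {W : Matrix ι ι ℝ} (hW : W.PosSemidef) {S : Set (ι → ℝ)}
    (hS : Convex ℝ S) {y p q : ι → ℝ} (hp : IsProjection W S y p) (hq : q ∈ S) :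
    (q - p) ⬝ᵥ W *ᵥ (q - p) + (p - y) ⬝ᵥ W *ᵥ (p - y) ≤ (q - y) ⬝ᵥ W *ᵥ (q - y) := by
  set a := p - y with ha
  set b := q - p with hb
  have hexp : ∀ c : ℝ, (a + c • b) ⬝ᵥ W *ᵥ (a + c • b)
      = a ⬝ᵥ W *ᵥ a + 2 * c * (a ⬝ᵥ W *ᵥ b) + c ^ 2 * (b ⬝ᵥ W *ᵥ b) := fun c => by
    simp only [mulVec_add, mulVec_smul, dotProduct_add, add_dotProduct, smul_dotProduct,
      dotProduct_smul, smul_eq_mul, dotProduct_mulVec_symm hW b a]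
    ring
  have hmin : ∀ c : ℝ, 0 ≤ c → c ≤ 1 → 0 ≤ c * (2 * (a ⬝ᵥ W *ᵥ b) + c * (b ⬝ᵥ W *ᵥ b)) := by
    intro c h0 h1
    have h := hp.2 (p + c • b) (hS.add_smul_sub_mem hp.1 hq ⟨h0, h1⟩)
    rw [add_sub_right_comm, hexp] at h
    linarith
  have hab : 0 ≤ a ⬝ᵥ W *ᵥ b := by
    by_contra! hneg
    have hbb := quadForm_nonneg hW b
    set α := a ⬝ᵥ W *ᵥ b
    set β := b ⬝ᵥ W *ᵥ b
    have hden : 0 < β - α := by linarith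
    -- If `α < 0`, this step stays in `(0, 1]` even when `β = 0`, and gives `2α + cβ ≤ α < 0`, so
    -- moving from `p` towards `q` would beat the minimizer.
    have h := hmin (-α / (β - α)) (div_nonneg (by linarith) hden.le)
      ((div_le_one hden).2 (by linarith))
    have hc : 0 < -α / (β - α) := div_pos (by linarith) hden
    have h' := nonneg_of_mul_nonneg_right h hc
    have : -α / (β - α) * β ≤ -α := by
      rw [div_mul_eq_mul_div, div_le_iff₀ hden]
      nlinarith
    linarith
  have hqy : q - y = a + (1 : ℝ) • b := by rw [ha, hb, one_smul]; abel
  rw [hqy, hexp]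
  linarith

variable [DecidableEq κι]

/-- The matrix `κ I + Zᵀ P Z` that normalizes the least-squares update. -/
abbrev normalizer (κ : ℝ) (P : Matrix ι ι ℝ) (Z : Matrix ι κι ℝ) : Matrix κι κι ℝ :=
  κ • (1 : Matrix κι κι ℝ) + Zᵀ * P * Z

variable {κ : ℝ} {P : Matrix ι ι ℝ}

theorem posDef_normalizer (hκ : 0 < κ) (hP : P.PosSemidef) (Z : Matrix ι κι ℝ) :
    (normalizer κ P Z).PosDef :=
  (PosDef.one.smul hκ).add_posSemidef (posSemidef_transpose_mul_mul hP Z)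

/-- This is the diagonal of `N⁻¹ ≤ κ⁻¹ I`, which comes from `N ≥ κ I`: for `w = N⁻¹ e_i`, one has
`w_i = wᵀNw ≥ κ w_i²`. -/
theorem normalizer_inv_diag_le (hκ : 0 < κ) (hP : P.PosSemidef) (Z : Matrix ι κι ℝ) (i : κι) :
    (normalizer κ P Z)⁻¹ i i ≤ κ⁻¹ := by
  have hN := posDef_normalizer hκ hP Z
  have hu : IsUnit (normalizer κ P Z).det := (isUnit_iff_isUnit_det _).1 hN.isUnit
  set w : κι → ℝ := (normalizer κ P Z)⁻¹ *ᵥ Pi.single i 1 with hw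
  have hwi : (normalizer κ P Z)⁻¹ i i = w i := by simp [hw]
  have h1 : w ⬝ᵥ normalizer κ P Z *ᵥ w = w i := by
    rw [hw, mulVec_mulVec, mul_nonsing_inv _ hu, one_mulVec]; simp
  rw [normalizer, add_mulVec, dotProduct_add, smul_mulVec, one_mulVec, dotProduct_smul,
    smul_eq_mul] at h1
  have h2 := quadForm_nonneg (posSemidef_transpose_mul_mul hP Z) w
  have h3 : w i * w i ≤ w ⬝ᵥ w :=
    Finset.single_le_sum (f := fun k => w k * w k) (fun k _ => mul_self_nonneg _)
      (Finset.mem_univ i)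
  have h4 : κ * (w i * w i) ≤ w i := by nlinarith
  rw [hwi, ← one_div, le_div_iff₀ hκ]
  by_contra! h
  have h5 : 0 < w i := by
    by_contra! h'
    nlinarith
  nlinarith

/-- The subtracted matrix is `(ZᵀP)ᵀ N⁻¹ (ZᵀP)`, which is positive semidefinite. -/
theorem gain_update_diag_le (hκ : 0 < κ) (hP : P.PosDef) (Z : Matrix ι κι ℝ) (i : ι) :
    (P - P * Z * (normalizer κ P Z)⁻¹ * Zᵀ * P) i i ≤ P i i := by
  have hN := (posDef_normalizer hκ hP.posSemidef Z).inv.posSemidef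
  have hPt : Pᵀ = P := by simpa [IsHermitian, conjTranspose_eq_transpose_of_trivial] using hP.1
  have h := (posSemidef_transpose_mul_mul hN (Zᵀ * P)).diag_nonneg (i := i)
  rw [transpose_mul, transpose_transpose, hPt, ← Matrix.mul_assoc] at h
  rw [Matrix.sub_apply]
  linarith

variable [DecidableEq ι]

/-- A Cauchy–Schwarz inequality in the metric of `P⁻¹`. -/
theorem sq_le_diag_mul_quadForm_inv (hP : P.PosDef) (v : ι → ℝ) (i : ι) :
    v i ^ 2 ≤ P i i * (v ⬝ᵥ P⁻¹ *ᵥ v) := by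
  have hd : 0 < P i i := hP.diag_pos
  have hu : IsUnit P.det := (isUnit_iff_isUnit_det P).1 hP.isUnit
  set e : ι → ℝ := Pi.single i 1 with he
  have h1 : P⁻¹ *ᵥ (P *ᵥ e) = e := by rw [mulVec_mulVec, nonsing_inv_mul _ hu, one_mulVec]
  have h2 : v ⬝ᵥ e = v i := by simp [he]
  have h3 : (P *ᵥ e) ⬝ᵥ e = P i i := by simp [he]
  have h4 : (P *ᵥ e) ⬝ᵥ P⁻¹ *ᵥ v = v i := by
    rw [dotProduct_mulVec_symm hP.inv.posSemidef, h1, h2]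
  -- The `P⁻¹`-form of this test vector is `P i i` times the required difference.
  have h := quadForm_nonneg hP.inv.posSemidef (P i i • v - v i • (P *ᵥ e))
  simp only [mulVec_sub, mulVec_smul, dotProduct_sub, sub_dotProduct, smul_dotProduct,
    dotProduct_smul, smul_eq_mul, h1, h2, h3, h4] at h
  have h5 : 0 ≤ P i i * (P i i * (v ⬝ᵥ P⁻¹ *ᵥ v) - v i ^ 2) := by linarith
  linarith [nonneg_of_mul_nonneg_right h5 hd]

/-- Apply the preceding inequality to column `j` of `P`, whose `P⁻¹`-form is `P j j`. It lets
diagonal bounds control all entries. -/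
theorem sq_apply_le_diag_mul_diag (hP : P.PosDef) (i j : ι) :
    P i j ^ 2 ≤ P i i * P j j := by
  have hu : IsUnit P.det := (isUnit_iff_isUnit_det P).1 hP.isUnit
  have h := sq_le_diag_mul_quadForm_inv hP (P *ᵥ Pi.single j 1) i
  rw [mulVec_mulVec, nonsing_inv_mul _ hu, one_mulVec] at h
  simpa using h

/-- Sherman–Morrison–Woodbury for the least-squares gain update. -/
theorem gain_update_inv (hκ : 0 < κ) (hP : P.PosDef) (Z : Matrix ι κι ℝ) :
    (P - P * Z * (normalizer κ P Z)⁻¹ * Zᵀ * P)⁻¹ = P⁻¹ + κ⁻¹ • (Z * Zᵀ) := by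
  have hN := posDef_normalizer hκ hP.posSemidef Z
  have hu : IsUnit (normalizer κ P Z).det := (isUnit_iff_isUnit_det _).1 hN.isUnit
  have hPu : IsUnit P.det := (isUnit_iff_isUnit_det _).1 hP.isUnit
  apply inv_eq_right_inv
  have h1 : (normalizer κ P Z)⁻¹ * (Zᵀ * P * Z) = 1 - κ • (normalizer κ P Z)⁻¹ := by
    have : Zᵀ * P * Z = normalizer κ P Z - κ • (1 : Matrix κι κι ℝ) := by
      simp [normalizer]
    rw [this, mul_sub, nonsing_inv_mul _ hu, Matrix.mul_smul, Matrix.mul_one]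
  have h2 : P * Z * (normalizer κ P Z)⁻¹ * Zᵀ * P * (Z * Zᵀ)
      = P * Z * Zᵀ - κ • (P * Z * (normalizer κ P Z)⁻¹ * Zᵀ) := by
    calc _ = P * Z * ((normalizer κ P Z)⁻¹ * (Zᵀ * P * Z)) * Zᵀ := by simp only [Matrix.mul_assoc]
      _ = _ := by rw [h1]; simp [Matrix.mul_sub, Matrix.sub_mul]
  rw [sub_mul, mul_add, mul_add, mul_nonsing_inv _ hPu, Matrix.mul_smul, Matrix.mul_smul, h2,
    mul_nonsing_inv_cancel_right _ _ hPu, smul_sub, smul_smul, inv_mul_cancel₀ hκ.ne', one_smul,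
    ← Matrix.mul_assoc]
  abel

theorem posDef_gain_update (hκ : 0 < κ) (hP : P.PosDef) (Z : Matrix ι κι ℝ) :
    (P - P * Z * (normalizer κ P Z)⁻¹ * Zᵀ * P).PosDef := by
  have hZ : (Z * Zᵀ).PosSemidef := by
    simpa [conjTranspose_eq_transpose_of_trivial] using posSemidef_self_mul_conjTranspose Z
  have h : (P⁻¹ + κ⁻¹ • (Z * Zᵀ)).PosDef :=
    hP.inv.add_posSemidef (hZ.smul (inv_nonneg.2 hκ.le))
  rw [← gain_update_inv hκ hP Z] at h
  exact (posDef_inv_iff).1 h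

/-- Completion of squares for the least-squares update: `d` is the parameter error, `P Z w` the
update and `N w` the estimation error. -/
theorem quadForm_update (hκ : 0 < κ) (hP : P.PosDef) (Z : Matrix ι κι ℝ) (d : ι → ℝ)
    (w : κι → ℝ) :
    (d - (P * Z) *ᵥ w) ⬝ᵥ (P⁻¹ + κ⁻¹ • (Z * Zᵀ)) *ᵥ (d - (P * Z) *ᵥ w)
        + (normalizer κ P Z *ᵥ w) ⬝ᵥ w
      = d ⬝ᵥ P⁻¹ *ᵥ d
        + κ⁻¹ * ((normalizer κ P Z *ᵥ w - Zᵀ *ᵥ d) ⬝ᵥ (normalizer κ P Z *ᵥ w - Zᵀ *ᵥ d)) := by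
  have hPu : IsUnit P.det := (isUnit_iff_isUnit_det _).1 hP.isUnit
  set v := (P * Z) *ᵥ w with hv
  -- Here `v` is the update. This identity and the next ones express every term, apart from `d ⬝ᵥ
  -- P⁻¹ *ᵥ d`, through `w`, `N w` and `Zᵀ d`, leaving scalar algebra.
  have hZv : Zᵀ *ᵥ v = normalizer κ P Z *ᵥ w - κ • w := by
    rw [hv, mulVec_mulVec, ← Matrix.mul_assoc, normalizer, add_mulVec, smul_mulVec, one_mulVec,
      add_sub_cancel_left]
  have hPv : P⁻¹ *ᵥ v = Z *ᵥ w := by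
    rw [hv, mulVec_mulVec, ← Matrix.mul_assoc, nonsing_inv_mul _ hPu, Matrix.one_mul]
  have hZ : ∀ y, y ⬝ᵥ Z *ᵥ w = (Zᵀ *ᵥ y) ⬝ᵥ w := fun y => by
    rw [dotProduct_mulVec, mulVec_transpose]
  have hvd : v ⬝ᵥ P⁻¹ *ᵥ d = (Zᵀ *ᵥ d) ⬝ᵥ w := by
    rw [dotProduct_mulVec_symm hP.inv.posSemidef, hPv, hZ]
  have hZZ : ∀ y, y ⬝ᵥ (Z * Zᵀ) *ᵥ y = (Zᵀ *ᵥ y) ⬝ᵥ (Zᵀ *ᵥ y) := fun y => by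
    rw [← mulVec_mulVec, dotProduct_mulVec, ← mulVec_transpose]
  have hdw := hZ d
  have hvw := hZ v
  rw [hZv] at hvw
  rw [add_mulVec, smul_mulVec, dotProduct_add, dotProduct_smul, hZZ, mulVec_sub, mulVec_sub,
    hZv, hPv]
  set ε := normalizer κ P Z *ᵥ w
  set a := Zᵀ *ᵥ d
  simp only [dotProduct_sub, sub_dotProduct, hvd, hdw, hvw, smul_dotProduct, dotProduct_smul,
    smul_eq_mul, dotProduct_comm w a, dotProduct_comm w ε, dotProduct_comm a ε]
  field_simp
  ring

/-- The left side equals `wᵀ Zᵀ P Z w = wᵀ(N - κ I)w`. For `w = N⁻¹ε` this bounds the unprojected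
parameter step by the normalized error. -/
theorem quadForm_inv_increment_le (hκ : 0 < κ) (hP : P.PosDef) (Z : Matrix ι κι ℝ) (w : κι → ℝ) :
    ((P * Z) *ᵥ w) ⬝ᵥ P⁻¹ *ᵥ ((P * Z) *ᵥ w) ≤ (normalizer κ P Z *ᵥ w) ⬝ᵥ w := by
  have hPu : IsUnit P.det := (isUnit_iff_isUnit_det _).1 hP.isUnit
  have h1 : P⁻¹ *ᵥ ((P * Z) *ᵥ w) = Z *ᵥ w := by
    rw [mulVec_mulVec, ← Matrix.mul_assoc, nonsing_inv_mul _ hPu, Matrix.one_mul]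
  rw [h1, dotProduct_mulVec, ← mulVec_transpose, mulVec_mulVec, normalizer, add_mulVec,
    add_dotProduct, smul_mulVec, one_mulVec, smul_dotProduct, ← Matrix.mul_assoc, smul_eq_mul]
  have h2 : 0 ≤ w ⬝ᵥ w := Finset.sum_nonneg fun k _ => mul_self_nonneg _
  linarith [mul_nonneg hκ.le h2]

end LeastSquares

theorem convex_admissible {n m : ℕ} (σ : Fin m → SignType) (kb : Fin m → ℝ) :
    Convex ℝ (admissible (n := n) σ kb) := by
  intro v hv w hw a b ha hb hab j
  have h1 := mul_le_mul_of_nonneg_left (hv j) ha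
  have h2 := mul_le_mul_of_nonneg_left (hw j) hb
  have h3 : a * (1 / kb j) + b * (1 / kb j) = 1 / kb j := by rw [← add_mul, hab, one_mul]
  simp only [Pi.add_apply, Pi.smul_apply, smul_eq_mul]
  linarith

/-! ### Bounded signals and elementary norm estimates -/

section Bounded

variable {ι ι' ι'' : Type}

theorem BoundedMatrixSignal.transpose {S : ℕ → Matrix ι ι' ℝ} (hS : BoundedMatrixSignal S) :
    BoundedMatrixSignal fun t => (S t)ᵀ :=
  let ⟨C, hC⟩ := hS
  ⟨C, fun t i j => hC t j i⟩

theorem BoundedSignal.sub {v w : ℕ → ι → ℝ} (hv : BoundedSignal v) (hw : BoundedSignal w) :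
    BoundedSignal fun t => v t - w t := by
  obtain ⟨α, hα⟩ := hv
  obtain ⟨β, hβ⟩ := hw
  exact ⟨α + β, fun t i => (abs_sub _ _).trans (add_le_add (hα t i) (hβ t i))⟩

theorem abs_sum_mul_le [Fintype ι] {a b : ι → ℝ} {α β : ℝ} (ha : ∀ i, |a i| ≤ α) (hb : ∀ i, |b i| ≤ β) :
    |∑ i, a i * b i| ≤ Fintype.card ι * (α * β) := by
  refine (Finset.abs_sum_le_sum_abs _ _).trans ?_
  refine (Finset.sum_le_card_nsmul _ _ (α * β) fun i _ => ?_).trans_eq (by simp)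
  rw [abs_mul]
  exact mul_le_mul (ha i) (hb i) (abs_nonneg _) ((abs_nonneg _).trans (ha i))

theorem BoundedMatrixSignal.mul [Fintype ι'] {S : ℕ → Matrix ι ι' ℝ} {T : ℕ → Matrix ι' ι'' ℝ}
    (hS : BoundedMatrixSignal S) (hT : BoundedMatrixSignal T) :
    BoundedMatrixSignal fun t => S t * T t := by
  obtain ⟨α, hα⟩ := hS
  obtain ⟨β, hβ⟩ := hT
  exact ⟨Fintype.card ι' * (α * β), fun t i j =>
    abs_sum_mul_le (fun k => hα t i k) fun k => hβ t k j⟩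

theorem BoundedMatrixSignal.mulVec [Fintype ι'] {S : ℕ → Matrix ι ι' ℝ} {v : ℕ → ι' → ℝ}
    (hS : BoundedMatrixSignal S) (hv : BoundedSignal v) :
    BoundedSignal fun t => S t *ᵥ v t := by
  obtain ⟨α, hα⟩ := hS
  obtain ⟨β, hβ⟩ := hv
  exact ⟨Fintype.card ι' * (α * β), fun t i =>
    abs_sum_mul_le (fun k => hα t i k) fun k => hβ t k⟩

variable [Fintype ι]

theorem boundedSignal_iff {v : ℕ → ι → ℝ} :
    BoundedSignal v ↔ ∃ C : ℝ, 0 ≤ C ∧ ∀ t, ‖v t‖ ≤ C := by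
  constructor
  · rintro ⟨C, hC⟩
    exact ⟨max C 0, le_max_right _ _, fun t => (pi_norm_le_iff_of_nonneg (le_max_right _ _)).2
      fun i => (hC t i).trans (le_max_left _ _)⟩
  · rintro ⟨C, -, hC⟩
    exact ⟨C, fun t i => (norm_le_pi_norm (v t) i).trans (hC t)⟩

theorem boundedSignal_of_tendsto_zero {v : ℕ → ι → ℝ} (hv : Tendsto v atTop (𝓝 0)) :
    BoundedSignal v := by
  obtain ⟨C, hC⟩ := hv.norm.bddAbove_range
  exact ⟨C, fun t i => (norm_le_pi_norm (v t) i).trans (hC ⟨t, rfl⟩)⟩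

theorem exists_norm_mulVec_le [Fintype ι'] (S : Matrix ι ι' ℝ) :
    ∃ b, 0 ≤ b ∧ ∀ v, ‖S *ᵥ v‖ ≤ b * ‖v‖ := by
  classical
  exact ⟨_, norm_nonneg _, (LinearMap.toContinuousLinearMap (Matrix.toLin' S)).le_opNorm⟩

theorem norm_le_sqrt_of_sq_le {v : ι → ℝ} {a : ℝ} (h : ∀ i, v i ^ 2 ≤ a) : ‖v‖ ≤ √a :=
  (pi_norm_le_iff_of_nonneg (Real.sqrt_nonneg _)).2 fun i => Real.abs_le_sqrt (h i)

theorem dotProduct_self_le (v : ι → ℝ) : v ⬝ᵥ v ≤ Fintype.card ι * ‖v‖ ^ 2 := by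
  refine (Finset.sum_le_card_nsmul _ _ (‖v‖ ^ 2) fun i _ => ?_).trans_eq (by simp)
  rw [← sq, ← sq_abs]
  exact pow_le_pow_left₀ (abs_nonneg _) (norm_le_pi_norm v i) 2

end Bounded

/-! ### Linearity and finite gain of the reference transfer matrix -/

section Transfer

variable {n m : ℕ} (Am : Matrix (Fin n) (Fin n) ℝ) (Bm : Matrix (Fin n) (Fin m) ℝ)

theorem transferMatrix_sum {ι : Type} (I : Finset ι) (c : ι → ℝ) (f : ι → ℕ → Fin m → ℝ) (t : ℕ) :
    transferMatrix Am Bm (fun τ => ∑ p ∈ I, c p • f p τ) t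
      = ∑ p ∈ I, c p • transferMatrix Am Bm (f p) t := by
  induction t with
  | zero => simp [transferMatrix]
  | succ t ih =>
    simp only [transferMatrix, ih, mulVec_sum, mulVec_smul, smul_add, Finset.sum_add_distrib]

theorem sum_transferEntry (v : ℕ → Fin m → ℝ) (i : Fin n) (t : ℕ) :
    ∑ j, transferEntry Am Bm i j (fun τ => v τ j) t = transferMatrix Am Bm v t i := by
  have h := transferMatrix_sum Am Bm Finset.univ (fun _ => (1 : ℝ))
    (fun j τ => Pi.single j (v τ j)) t
  simp only [one_smul, Finset.univ_sum_single] at h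
  rw [h, Finset.sum_apply]
  rfl

variable {Am}

/-- The zero initial state removes the transient from the stable input bound. Only inputs strictly
before `t` enter, which is what later prevents an algebraic loop. -/
theorem ContractingNorm.exists_gain (N : ContractingNorm Am) :
    ∃ G, 0 ≤ G ∧ ∀ (v : ℕ → Fin m → ℝ) (t : ℕ) (V : ℝ), 0 ≤ V → (∀ τ < t, ‖v τ‖ ≤ V) →
      ‖transferMatrix Am Bm v t‖ ≤ G * V := by
  obtain ⟨b, hb0, hb⟩ := exists_norm_mulVec_le Bm
  have h1 : 0 < 1 - N.rate := by linarith [N.rate_lt_one]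
  have h2 := N.bound_nonneg
  refine ⟨N.bound * b / (1 - N.rate), by positivity, fun v t V hV hv => ?_⟩
  have h := N.norm_le_of_input_le (y := transferMatrix Am Bm v) (f := fun τ => Bm *ᵥ v τ) (t := t)
    (fun τ _ => rfl) (mul_nonneg hb0 hV)
    (fun τ hτ => (hb _).trans (mul_le_mul_of_nonneg_left (hv τ hτ) hb0)) t le_rfl
  have h0 : N.toFun (transferMatrix Am Bm v 0) ≤ 0 := by
    simpa [transferMatrix] using N.le_bound 0
  calc _ ≤ _ := h
    _ ≤ 0 + N.bound * (b * V) / (1 - N.rate) := by gcongr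
    _ = _ := by ring

end Transfer

/-! ### The ideal parameter and the admissible set -/

/-- The ideal parameters `θ*`, for which the estimation error vanishes. -/
noncomputable def idealParam {n m : ℕ} (K₁ : Matrix (Fin n) (Fin m) ℝ) (k : Fin m → ℝ) : ParamIdx n m → ℝ :=
  fun p => Sum.elim (fun l => K₁ l p.1 / k p.1) (fun _ => 1 / k p.1) p.2

/-- Since `θ*_2j = 1 / k_j` has the sign of `k_j`, the constraint becomes `1 / kb_j ≤ 1 / |k_j|`.
Membership makes `θ*` a legitimate comparison point for the projection. -/
theorem idealParam_mem_admissible {n m : ℕ} (K₁ : Matrix (Fin n) (Fin m) ℝ) {k : Fin m → ℝ}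
    (hk : ∀ j, k j ≠ 0) {σ : Fin m → SignType} (hσ : ∀ j, σ j = SignType.sign (k j))
    {kb : Fin m → ℝ} (hkb : ∀ j, |k j| ≤ kb j) : idealParam K₁ k ∈ admissible σ kb := by
  intro j
  have h1 : ((σ j : SignType) : ℝ) * (1 / k j) = 1 / |k j| := by
    rw [hσ]
    rcases lt_or_gt_of_ne (hk j) with h | h
    · rw [sign_neg h, abs_of_neg h, SignType.coe_neg_one, one_div_neg_eq_neg_one_div]; ring
    · rw [sign_pos h, abs_of_pos h, SignType.coe_one, one_mul]
  exact (one_div_le_one_div_of_le (abs_pos.2 (hk j)) (hkb j)).trans_eq h1.symm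

theorem one_div_le_abs_of_mem_admissible {n m : ℕ} {σ : Fin m → SignType} {kb : Fin m → ℝ}
    {ϑ : ParamIdx n m → ℝ} (h : ϑ ∈ admissible σ kb) (j : Fin m) :
    1 / kb j ≤ |ϑ (j, Sum.inr ())| := by
  refine (h j).trans ((le_abs_self _).trans ?_)
  rw [abs_mul]
  refine mul_le_of_le_one_left (abs_nonneg _) ?_
  cases σ j <;> simp

/-! ### Regression form and the swapping identity -/

namespace Signals

variable {n m : ℕ} (s : Signals n m)

/-- The outputs `ϑ_jᵀ ω_j(t)` of the regressors, for a parameter vector `ϑ`. -/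
def regression (ϑ : ParamIdx n m → ℝ) (t : ℕ) : Fin m → ℝ :=
  fun j => ∑ k, ϑ (j, k) * s.ω t (j, k)

theorem regression_eq_sum (ϑ : ParamIdx n m → ℝ) (t : ℕ) :
    s.regression ϑ t = ∑ p, ϑ p • (Pi.single p.1 (s.ω t p) : Fin m → ℝ) := by
  funext j
  simp only [regression, Fintype.sum_prod_type, Finset.sum_apply, Pi.smul_apply, smul_eq_mul]
  rw [Finset.sum_eq_single j]
  · simp
  · intro j' _ hj
    simp [Pi.single_eq_of_ne (Ne.symm hj)]
  · simp

theorem regression_eq (ϑ : ParamIdx n m → ℝ) (t : ℕ) (j : Fin m) :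
    s.regression ϑ t j
      = ϑ (j, Sum.inr ()) * s.u t j - ∑ l, ϑ (j, Sum.inl l) * s.x t l := by
  simp [regression, ω]
  ring

variable (Am : Matrix (Fin n) (Fin n) ℝ) (Bm : Matrix (Fin n) (Fin m) ℝ)

/-- A constant parameter vector commutes with the linear filter; time variation of `θ` is the only
source of the swapping error. -/
theorem transpose_Z_mulVec (ϑ : ParamIdx n m → ℝ) (t : ℕ) :
    (s.Z Am Bm t)ᵀ *ᵥ ϑ = transferMatrix Am Bm (s.regression ϑ) t := by
  have h : s.regression ϑ = fun τ => ∑ p, ϑ p • (Pi.single p.1 (s.ω τ p) : Fin m → ℝ) :=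
    funext (s.regression_eq_sum ϑ)
  rw [h, transferMatrix_sum]
  funext i
  simp only [mulVec, dotProduct, transpose_apply, Finset.sum_apply, Pi.smul_apply, smul_eq_mul]
  exact Finset.sum_congr rfl fun p _ => mul_comm _ _

/-- The sum `∑_j ξ_ij`, as a vector indexed by `i`. -/
def swappingError (t : ℕ) : Fin n → ℝ := fun i => ∑ j, s.ξ Am Bm i j t

theorem swappingError_eq (t : ℕ) : s.swappingError Am Bm t
    = (s.Z Am Bm t)ᵀ *ᵥ s.θ t - transferMatrix Am Bm (fun τ => s.regression (s.θ τ) τ) t := by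
  funext i
  rw [Pi.sub_apply, ← sum_transferEntry]
  simp only [swappingError, ξ, Finset.sum_sub_distrib, regression]
  congr 1
  simp only [mulVec, dotProduct, transpose_apply, Fintype.sum_prod_type]
  exact Finset.sum_congr rfl fun j _ => Finset.sum_congr rfl fun k _ => mul_comm _ _

/-- With the parameters frozen at `θ(t)`, filtered and unfiltered products evolve identically, so
only the increment of `θ` acts as a source. Slow adaptation thus makes this error small relative to
`Z`. -/
theorem swappingError_succ (t : ℕ) : s.swappingError Am Bm (t + 1)
    = Am *ᵥ s.swappingError Am Bm t + (s.Z Am Bm (t + 1))ᵀ *ᵥ (s.θ (t + 1) - s.θ t) := by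
  have h : (s.Z Am Bm (t + 1))ᵀ *ᵥ s.θ t
      = Am *ᵥ ((s.Z Am Bm t)ᵀ *ᵥ s.θ t) + Bm *ᵥ s.regression (s.θ t) t := by
    rw [transpose_Z_mulVec, transpose_Z_mulVec, transferMatrix]
  rw [swappingError_eq, swappingError_eq, transferMatrix, mulVec_sub, mulVec_sub, h]
  abel

theorem swappingError_zero : s.swappingError Am Bm 0 = 0 := by
  rw [swappingError_eq, transpose_Z_mulVec, transferMatrix, transferMatrix, sub_zero]

theorem ε_eq (t : ℕ) : s.ε Am Bm t = s.ex t + s.swappingError Am Bm t := rfl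

end Signals

/-! ### Closed-loop error model and Lyapunov descent -/

namespace IsClosedLoop

variable {n m : ℕ} {A : Matrix (Fin n) (Fin n) ℝ} {B : Matrix (Fin n) (Fin m) ℝ}
  {Am : Matrix (Fin n) (Fin n) ℝ} {Bm : Matrix (Fin n) (Fin m) ℝ} {r : ℕ → Fin m → ℝ}
  {σ : Fin m → SignType} {kb : Fin m → ℝ} {κ : ℝ}
  {P₀ : Matrix (ParamIdx n m) (ParamIdx n m) ℝ} {θ₀ : ParamIdx n m → ℝ} {s : Signals n m}

theorem posDef_gain (hs : IsClosedLoop A B Am Bm r σ kb κ P₀ θ₀ s) (hκ : 0 < κ)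
    (hP₀ : P₀.PosDef) (t : ℕ) : (s.Pprev t).PosDef := by
  induction t with
  | zero => rwa [hs.gain_init]
  | succ t ih =>
    rw [hs.gain_update]
    exact posDef_gain_update hκ ih _

theorem gain_diag_le (hs : IsClosedLoop A B Am Bm r σ kb κ P₀ θ₀ s) (hκ : 0 < κ)
    (hP₀ : P₀.PosDef) (t : ℕ) (p : ParamIdx n m) : s.Pprev t p p ≤ P₀.trace := by
  have h : s.Pprev t p p ≤ P₀ p p := by
    induction t with
    | zero => rw [hs.gain_init]
    | succ t ih =>
      rw [hs.gain_update]
      exact (gain_update_diag_le hκ (hs.posDef_gain hκ hP₀ t) _ p).trans ih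
  exact h.trans (Finset.single_le_sum (f := fun p => P₀ p p)
    (fun q _ => hP₀.posSemidef.diag_nonneg) (Finset.mem_univ p))

/-- Positive definiteness reduces all entries to the diagonal, and the diagonal never exceeds that
of `P₀`. -/
theorem abs_gain_le (hs : IsClosedLoop A B Am Bm r σ kb κ P₀ θ₀ s) (hκ : 0 < κ)
    (hP₀ : P₀.PosDef) (t : ℕ) (p q : ParamIdx n m) : |s.Pprev t p q| ≤ P₀.trace := by
  have hP := hs.posDef_gain hκ hP₀ t
  have htr : 0 ≤ P₀.trace := hP₀.posSemidef.trace_nonneg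
  refine abs_le_of_sq_le_sq ((sq_apply_le_diag_mul_diag hP p q).trans ?_) htr
  rw [sq]
  exact mul_le_mul (hs.gain_diag_le hκ hP₀ t p) (hs.gain_diag_le hκ hP₀ t q)
    hP.posSemidef.diag_nonneg htr

theorem param_mem (hs : IsClosedLoop A B Am Bm r σ kb κ P₀ θ₀ s) (hθ₀ : θ₀ ∈ admissible σ kb) :
    ∀ t, s.θ t ∈ admissible σ kb
  | 0 => by rwa [hs.param_init]
  | t + 1 => (hs.param_update t).1

theorem isUnit_Θ₂ (hs : IsClosedLoop A B Am Bm r σ kb κ P₀ θ₀ s) (hθ₀ : θ₀ ∈ admissible σ kb)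
    (hkb : ∀ j, 0 < kb j) (t : ℕ) : IsUnit (s.Θ₂ t) := by
  rw [Signals.Θ₂, isUnit_diagonal, Pi.isUnit_iff]
  intro j
  rw [isUnit_iff_ne_zero, ← abs_pos]
  exact (one_div_pos.2 (hkb j)).trans_le
    (one_div_le_abs_of_mem_admissible (hs.param_mem hθ₀ t) j)

theorem abs_inv_Θ₂_le (hs : IsClosedLoop A B Am Bm r σ kb κ P₀ θ₀ s)
    (hθ₀ : θ₀ ∈ admissible σ kb) (hkb : ∀ j, 0 < kb j) (t : ℕ) (i j : Fin m) :
    |(s.Θ₂ t)⁻¹ i j| ≤ ∑ j, kb j := by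
  have hpos : ∀ j, 1 / kb j ≤ |s.θ t (j, Sum.inr ())| :=
    one_div_le_abs_of_mem_admissible (hs.param_mem hθ₀ t)
  have hinv : (s.Θ₂ t)⁻¹ = diagonal fun j => (s.θ t (j, Sum.inr ()))⁻¹ := by
    refine inv_eq_left_inv ?_
    rw [Signals.Θ₂, diagonal_mul_diagonal, ← diagonal_one]
    congr 1
    funext j
    exact inv_mul_cancel₀ (abs_pos.1 ((one_div_pos.2 (hkb j)).trans_le (hpos j)))
  have hle : kb j ≤ ∑ j, kb j :=
    Finset.single_le_sum (fun j _ => (hkb j).le) (Finset.mem_univ j)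
  rw [hinv, diagonal_apply]
  split_ifs with hij
  · subst hij
    rw [abs_inv]
    have := inv_anti₀ (one_div_pos.2 (hkb i)) (hpos i)
    rw [one_div, inv_inv] at this
    exact this.trans hle
  · rw [abs_zero]
    exact (hkb j).le.trans hle

/-- Multiplying the control law by `Θ₂` gives `Θ₂ u - Θ₁ᵀ x = r`, so the estimator input is just the
reference. -/
theorem regression_self (hs : IsClosedLoop A B Am Bm r σ kb κ P₀ θ₀ s)
    (hθ₀ : θ₀ ∈ admissible σ kb) (hkb : ∀ j, 0 < kb j) (t : ℕ) :
    s.regression (s.θ t) t = r t := by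
  have hu : IsUnit (s.Θ₂ t).det := (isUnit_iff_isUnit_det _).1 (hs.isUnit_Θ₂ hθ₀ hkb t)
  have h : s.Θ₂ t *ᵥ s.u t = (s.Θ₁ t)ᵀ *ᵥ s.x t + r t := by
    conv_lhs => rw [hs.control t]
    rw [mulVec_mulVec, mul_nonsing_inv _ hu, one_mulVec]
  funext j
  have hj := congrFun h j
  rw [Signals.Θ₂, mulVec_diagonal, Pi.add_apply] at hj
  rw [s.regression_eq, hj, sub_eq_iff_eq_add']
  rfl

theorem estimator_eq (hs : IsClosedLoop A B Am Bm r σ kb κ P₀ θ₀ s)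
    (hθ₀ : θ₀ ∈ admissible σ kb) (hkb : ∀ j, 0 < kb j) (t : ℕ) :
    s.xhat (t + 1) = Am *ᵥ s.xhat t + Bm *ᵥ r t := by
  rw [hs.estimator, ← hs.regression_self hθ₀ hkb t]
  congr 2
  funext j
  rw [s.regression_eq, Pi.sub_apply, Signals.Θ₂, mulVec_diagonal]
  rfl

/-- Since `θ*` collects `K₁ / k` and `1 / k`, scaling its regression by `diag(k)` yields `u - K₁ᵀ
x`; matching then replaces `(A, B)` by `(A_m, B_m)`. -/
theorem plant_eq (hs : IsClosedLoop A B Am Bm r σ kb κ P₀ θ₀ s)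
    {K₁ : Matrix (Fin n) (Fin m) ℝ} {k : Fin m → ℝ} (hk : ∀ j, k j ≠ 0)
    (hA : A + B * K₁ᵀ = Am) (hB : B * diagonal k = Bm) (t : ℕ) :
    s.x (t + 1) = Am *ᵥ s.x t + Bm *ᵥ s.regression (idealParam K₁ k) t := by
  have h : diagonal k *ᵥ s.regression (idealParam K₁ k) t = s.u t - K₁ᵀ *ᵥ s.x t := by
    funext j
    rw [mulVec_diagonal, s.regression_eq, Pi.sub_apply, mul_sub, Finset.mul_sum]
    congr 1
    · simp [idealParam, hk j]
    · refine Finset.sum_congr rfl fun l _ => ?_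
      simp only [idealParam, Sum.elim_inl, transpose_apply]
      rw [← mul_assoc, mul_div_cancel₀ _ (hk j)]
  rw [hs.plant, ← hA, ← hB, ← mulVec_mulVec, h, add_mulVec, mulVec_sub, mulVec_mulVec]
  abel

/-- The estimation error differs from `Zᵀ(θ - θ*)` by a free response of the reference model. -/
theorem disturbance_succ (hs : IsClosedLoop A B Am Bm r σ kb κ P₀ θ₀ s)
    (hθ₀ : θ₀ ∈ admissible σ kb) (hkb : ∀ j, 0 < kb j)
    {K₁ : Matrix (Fin n) (Fin m) ℝ} {k : Fin m → ℝ} (hk : ∀ j, k j ≠ 0)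
    (hA : A + B * K₁ᵀ = Am) (hB : B * diagonal k = Bm) (t : ℕ) :
    s.ε Am Bm (t + 1) - (s.Z Am Bm (t + 1))ᵀ *ᵥ (s.θ (t + 1) - idealParam K₁ k)
      = Am *ᵥ (s.ε Am Bm t - (s.Z Am Bm t)ᵀ *ᵥ (s.θ t - idealParam K₁ k)) := by
  have h : ∀ t, s.ε Am Bm t - (s.Z Am Bm t)ᵀ *ᵥ (s.θ t - idealParam K₁ k)
      = s.xhat t - s.x t + transferMatrix Am Bm (s.regression (idealParam K₁ k)) t
        - transferMatrix Am Bm (fun τ => s.regression (s.θ τ) τ) t := fun t => by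
    rw [s.ε_eq, s.swappingError_eq, mulVec_sub, s.transpose_Z_mulVec Am Bm (idealParam K₁ k),
      Signals.ex]
    abel
  rw [h, h, hs.estimator_eq hθ₀ hkb, hs.plant_eq hk hA hB, transferMatrix, transferMatrix,
    hs.regression_self hθ₀ hkb]
  simp only [mulVec_sub, mulVec_add]
  abel

/-- The parameter estimates are bounded, and the normalized estimation error and the parameter
increments tend to zero. -/
theorem adaptation (hs : IsClosedLoop A B Am Bm r σ kb κ P₀ θ₀ s)
    (N : ContractingNorm Am) (hκ : 0 < κ) (hP₀ : P₀.PosDef)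
    (hθ₀ : θ₀ ∈ admissible σ kb) (hkb : ∀ j, 0 < kb j)
    {K₁ : Matrix (Fin n) (Fin m) ℝ} {k : Fin m → ℝ} (hk : ∀ j, k j ≠ 0)
    (hideal : idealParam K₁ k ∈ admissible σ kb)
    (hA : A + B * K₁ᵀ = Am) (hB : B * diagonal k = Bm) :
    BoundedSignal s.θ ∧
      Tendsto (fun t => s.ε Am Bm t ⬝ᵥ (s.N Am Bm κ t)⁻¹ *ᵥ s.ε Am Bm t) atTop (𝓝 0) ∧
      Tendsto (fun t => s.θ (t + 1) - s.θ t) atTop (𝓝 0) := by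
  set ϑ := idealParam K₁ k
  have hP := hs.posDef_gain hκ hP₀
  have hPinv := fun t => (hP t).inv.posSemidef
  have hN : ∀ t, (s.N Am Bm κ t).PosDef := fun t => posDef_normalizer hκ (hP t).posSemidef _
  have htr : 0 ≤ P₀.trace := hP₀.posSemidef.trace_nonneg
  set V : ℕ → ℝ := fun t => (s.θ t - ϑ) ⬝ᵥ (s.Pprev t)⁻¹ *ᵥ (s.θ t - ϑ) with hV
  set a : ℕ → ℝ := fun t => s.ε Am Bm t ⬝ᵥ (s.N Am Bm κ t)⁻¹ *ᵥ s.ε Am Bm t with ha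
  set b : ℕ → ℝ := fun t => (s.θ (t + 1) - s.lsUpdate Am Bm κ t) ⬝ᵥ
    (s.Pprev (t + 1))⁻¹ *ᵥ (s.θ (t + 1) - s.lsUpdate Am Bm κ t) with hb
  set η : ℕ → Fin n → ℝ := fun t => s.ε Am Bm t - (s.Z Am Bm t)ᵀ *ᵥ (s.θ t - ϑ) with hη
  have ha0 : ∀ t, 0 ≤ a t := fun t => quadForm_nonneg (hN t).inv.posSemidef _
  have hb0 : ∀ t, 0 ≤ b t := fun t => quadForm_nonneg (hPinv _) _
  have hV0 : ∀ t, 0 ≤ V t := fun t => quadForm_nonneg (hPinv _) _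
  have hNε : ∀ t, normalizer κ (s.Pprev t) (s.Z Am Bm t) *ᵥ
      ((s.N Am Bm κ t)⁻¹ *ᵥ s.ε Am Bm t) = s.ε Am Bm t := fun t => by
    rw [mulVec_mulVec]
    change (s.N Am Bm κ t * (s.N Am Bm κ t)⁻¹) *ᵥ _ = _
    rw [mul_nonsing_inv _ ((isUnit_iff_isUnit_det _).1 (hN t).isUnit), one_mulVec]
  -- The Pythagorean inequality gives `V (t + 1) + b t` at most the `P(t)⁻¹`-distance from `ϑ` to
  -- the unprojected update, and completing squares shows that this distance plus `a t` is the right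
  -- side.
  have hstep : ∀ t, V (t + 1) + (a t + b t) ≤ V t + κ⁻¹ * (η t ⬝ᵥ η t) := by
    intro t
    have h1 := (hs.param_update t).pythagoras (hPinv (t + 1)) (convex_admissible σ kb) hideal
    have h2 := quadForm_update hκ (hP t) (s.Z Am Bm t) (s.θ t - ϑ)
      ((s.N Am Bm κ t)⁻¹ *ᵥ s.ε Am Bm t)
    rw [hNε, ← gain_update_inv hκ (hP t)] at h2
    have h3 : s.Pprev (t + 1) = s.Pprev t - s.Pprev t * s.Z Am Bm t *
      (normalizer κ (s.Pprev t) (s.Z Am Bm t))⁻¹ * (s.Z Am Bm t)ᵀ * s.Pprev t := hs.gain_update t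
    have h4 : s.θ t - ϑ - (s.Pprev t * s.Z Am Bm t) *ᵥ ((s.N Am Bm κ t)⁻¹ *ᵥ s.ε Am Bm t)
        = -(ϑ - s.lsUpdate Am Bm κ t) := by
      rw [Signals.lsUpdate, mulVec_mulVec]; abel
    have h5 : ϑ - s.θ (t + 1) = -(s.θ (t + 1) - ϑ) := by abel
    rw [← h3, h4, mulVec_neg, neg_dotProduct_neg] at h2
    rw [h5, mulVec_neg, neg_dotProduct_neg] at h1
    simp only [hV, ha, hb, hη]
    linarith
  have hsum : Summable fun t => κ⁻¹ * (η t ⬝ᵥ η t) := by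
    have h := (N.summable_sq (y := η) (hs.disturbance_succ hθ₀ hkb hk hA hB)).mul_left (n : ℝ)
    refine (h.of_nonneg_of_le (fun t => ?_) fun t => ?_).mul_left κ⁻¹
    · exact Finset.sum_nonneg fun i _ => mul_self_nonneg _
    · simpa using dotProduct_self_le (η t)
  obtain ⟨⟨C, hC⟩, hab⟩ := bounded_and_tendsto_zero_of_descent hV0
    (fun t => add_nonneg (ha0 t) (hb0 t))
    (fun t => mul_nonneg (inv_nonneg.2 hκ.le) (Finset.sum_nonneg fun i _ => mul_self_nonneg _))
    hsum hstep
  refine ⟨⟨√(P₀.trace * C) + ‖ϑ‖, fun t p => ?_⟩, ?_, ?_⟩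
  · have h1 := sq_le_diag_mul_quadForm_inv (hP t) (s.θ t - ϑ) p
    have h2 : s.Pprev t p p * V t ≤ P₀.trace * C :=
      mul_le_mul (hs.gain_diag_le hκ hP₀ t p) (hC t) (hV0 t) htr
    have h3 := Real.abs_le_sqrt (h1.trans h2)
    have h4 := norm_le_pi_norm ϑ p
    rw [Pi.sub_apply] at h3
    rw [Real.norm_eq_abs] at h4
    linarith [abs_sub_abs_le_abs_sub (s.θ t p) (ϑ p)]
  · exact squeeze_zero ha0 (fun t => le_add_of_nonneg_right (hb0 t)) hab
  · have hlim : Tendsto (fun t => √(P₀.trace * (a t + b t)) + √(P₀.trace * (a t + b t))) atTop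
        (𝓝 0) := by
      have h := (Real.continuous_sqrt.tendsto _).comp (hab.const_mul P₀.trace)
      simpa using h.add h
    refine squeeze_zero_norm (fun t => ?_) hlim
    -- The increment splits into the projection displacement, measured by `b t` in the metric
    -- `P(t)⁻¹`, and the least-squares step, measured by `a t` in the metric `P(t-1)⁻¹`.
    have h1 : s.θ (t + 1) - s.θ t = (s.θ (t + 1) - s.lsUpdate Am Bm κ t)
        - (s.Pprev t * s.Z Am Bm t) *ᵥ ((s.N Am Bm κ t)⁻¹ *ᵥ s.ε Am Bm t) := by
      rw [Signals.lsUpdate, mulVec_mulVec]; abel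
    rw [h1]
    refine (norm_sub_le _ _).trans (add_le_add ?_ ?_)
    · refine norm_le_sqrt_of_sq_le fun p => ?_
      refine (sq_le_diag_mul_quadForm_inv (hP (t + 1)) _ p).trans ?_
      exact mul_le_mul (hs.gain_diag_le hκ hP₀ _ p) (le_add_of_nonneg_left (ha0 t)) (hb0 t) htr
    · refine norm_le_sqrt_of_sq_le fun p => ?_
      refine (sq_le_diag_mul_quadForm_inv (hP t) _ p).trans ?_
      refine mul_le_mul (hs.gain_diag_le hκ hP₀ _ p) ?_ (quadForm_nonneg (hPinv t) _) htr
      refine (quadForm_inv_increment_le hκ (hP t) _ _).trans ?_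
      rw [hNε]
      exact le_add_of_nonneg_right (hb0 t)

end IsClosedLoop

/-! ### Regressor growth and the vanishing loop gain -/

namespace IsClosedLoop

variable {n m : ℕ} {A : Matrix (Fin n) (Fin n) ℝ} {B : Matrix (Fin n) (Fin m) ℝ}
  {Am : Matrix (Fin n) (Fin n) ℝ} {Bm : Matrix (Fin n) (Fin m) ℝ} {r : ℕ → Fin m → ℝ}
  {σ : Fin m → SignType} {kb : Fin m → ℝ} {κ : ℝ}
  {P₀ : Matrix (ParamIdx n m) (ParamIdx n m) ℝ} {θ₀ : ParamIdx n m → ℝ} {s : Signals n m}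

/-- The control input and the regressors grow at most linearly with the state. -/
theorem exists_norm_ω_le (hs : IsClosedLoop A B Am Bm r σ kb κ P₀ θ₀ s)
    (hr : BoundedSignal r) (hθ₀ : θ₀ ∈ admissible σ kb) (hkb : ∀ j, 0 < kb j)
    (hθ : BoundedSignal s.θ) :
    ∃ c, 0 ≤ c ∧ ∀ t R, 0 ≤ R → ‖s.x t‖ ≤ R → ∀ p, |s.ω t p| ≤ c * (1 + R) := by
  obtain ⟨D, hD0, hD⟩ := boundedSignal_iff.1 hr
  obtain ⟨E, hE0, hE⟩ := boundedSignal_iff.1 hθ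
  have hK : 0 ≤ ∑ j, kb j := Finset.sum_nonneg fun j _ => (hkb j).le
  -- The `1` serves the state entries; the other constant combines the bounds on `Θ₂⁻¹`, `Θ₁` and
  -- `r` for the input entries.
  refine ⟨max 1 (m * ((∑ j, kb j) * (n * E + D))), by positivity, fun t R hR hx p => ?_⟩
  have hx' : ∀ l, |s.x t l| ≤ R := fun l => (norm_le_pi_norm _ l).trans hx
  have h1R : (0 : ℝ) ≤ 1 + R := by linarith
  rcases p with ⟨j, l | l⟩
  · have h1 : |s.ω t (j, Sum.inl l)| ≤ 1 * (1 + R) := by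
      simp only [Signals.ω, Sum.elim_inl, abs_neg]
      linarith [hx' l]
    exact h1.trans (mul_le_mul_of_nonneg_right (le_max_left _ _) h1R)
  · have h2 : ∀ i, |((s.Θ₁ t)ᵀ *ᵥ s.x t + r t) i| ≤ (n * E + D) * (1 + R) := fun i => by
      have h3 : |((s.Θ₁ t)ᵀ *ᵥ s.x t) i| ≤ n * (E * R) := by
        exact (abs_sum_mul_le (a := fun l => (s.Θ₁ t)ᵀ i l) (b := s.x t)
          (fun l => (norm_le_pi_norm (s.θ t) (i, Sum.inl l)).trans (hE t)) hx').trans_eq (by simp)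
      have h4 : |r t i| ≤ D := (norm_le_pi_norm (r t) i).trans (hD t)
      refine (abs_add_le _ _).trans ((add_le_add h3 h4).trans ?_)
      have : 0 ≤ n * E + D * R := by positivity
      linarith
    have h5 : |s.u t j| ≤ m * ((∑ j, kb j) * ((n * E + D) * (1 + R))) := by
      rw [hs.control]
      exact (abs_sum_mul_le (a := fun l => (s.Θ₂ t)⁻¹ j l)
        (fun l => hs.abs_inv_Θ₂_le hθ₀ hkb t j l) h2).trans_eq (by simp)
    have h6 : |s.ω t (j, Sum.inr l)| ≤ m * ((∑ j, kb j) * (n * E + D)) * (1 + R) :=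
      h5.trans_eq (by ring)
    exact h6.trans (mul_le_mul_of_nonneg_right (le_max_right _ _) h1R)

/-- The estimator error is bounded by the past of the state, with a gain that tends to zero. -/
theorem exists_vanishing_gain (hs : IsClosedLoop A B Am Bm r σ kb κ P₀ θ₀ s)
    (N : ContractingNorm Am) (hκ : 0 < κ) (hP₀ : P₀.PosDef)
    (hr : BoundedSignal r) (hθ₀ : θ₀ ∈ admissible σ kb) (hkb : ∀ j, 0 < kb j)
    {K₁ : Matrix (Fin n) (Fin m) ℝ} {k : Fin m → ℝ} (hk : ∀ j, k j ≠ 0)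
    (hideal : idealParam K₁ k ∈ admissible σ kb)
    (hA : A + B * K₁ᵀ = Am) (hB : B * diagonal k = Bm) :
    ∃ γ : ℕ → ℝ, Tendsto γ atTop (𝓝 0) ∧ ∀ t R, 0 ≤ R → (∀ τ < t, ‖s.x τ‖ ≤ R) →
      ‖s.ex t‖ ≤ γ t * (1 + R) := by
  obtain ⟨hθ, ha, hΔ⟩ := hs.adaptation N hκ hP₀ hθ₀ hkb hk hideal hA hB
  obtain ⟨c, hc0, hc⟩ := hs.exists_norm_ω_le hr hθ₀ hkb hθ
  obtain ⟨G, hG0, hG⟩ := N.exists_gain Bm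
  have hP := hs.posDef_gain hκ hP₀
  have hN : ∀ t, (s.N Am Bm κ t).PosDef := fun t => posDef_normalizer hκ (hP t).posSemidef _
  have htr : 0 ≤ P₀.trace := hP₀.posSemidef.trace_nonneg
  set d : ℝ := (Fintype.card (ParamIdx n m) : ℝ)
  set a : ℕ → ℝ := fun t => s.ε Am Bm t ⬝ᵥ (s.N Am Bm κ t)⁻¹ *ᵥ s.ε Am Bm t
  have ha0 : ∀ t, 0 ≤ a t := fun t => quadForm_nonneg (hN t).inv.posSemidef _
  have hd0 : 0 ≤ d := Nat.cast_nonneg _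
  have hb0 := N.bound_nonneg
  -- A comparison recursion for the swapping error divided by `1 + R`. It does not depend on `R` and
  -- starts at 0, as the swapping error does.
  set g : ℕ → ℝ := fun t => Nat.rec 0
    (fun τ y => N.rate * y + N.bound * (d * (G * c * ‖s.θ (τ + 1) - s.θ τ‖))) t with hg
  have hgs : ∀ t, g (t + 1)
      = N.rate * g t + N.bound * (d * (G * c * ‖s.θ (t + 1) - s.θ t‖)) := fun t => rfl
  have hg0 : ∀ t, 0 ≤ g t := by
    intro t
    induction t with
    | zero => exact le_rfl
    | succ t ih =>
      rw [hgs]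
      have := N.rate_nonneg
      positivity
  have hglim : Tendsto g atTop (𝓝 0) := by
    refine tendsto_zero_of_recursion_le N.rate_nonneg N.rate_lt_one hg0 (fun t => (hgs t).le) ?_
    simpa using (((hΔ.norm.const_mul (G * c)).const_mul d).const_mul N.bound)
  -- Chosen so that the diagonal of `N(t)` is at most `K (1 + R)²`.
  set K : ℝ := κ + d * (d * (G * c * P₀.trace) * (G * c)) with hK
  have halim : Tendsto (fun t => √(K * a t)) atTop (𝓝 0) := by
    simpa [Function.comp_def] using (Real.continuous_sqrt.tendsto _).comp (ha.const_mul K)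
  refine ⟨fun t => √(K * a t) + g t, by simpa using halim.add hglim, fun t R hR hx => ?_⟩
  have h1R : 0 ≤ 1 + R := by linarith
  -- Strict causality: `Z` up to time `t` inclusive uses the state only before `t`, where the bound
  -- `R` is available.
  have hZ : ∀ τ ≤ t, ∀ p i, |s.Z Am Bm τ p i| ≤ G * c * (1 + R) := by
    intro τ hτ p i
    refine (norm_le_pi_norm (transferMatrix Am Bm _ τ) i).trans ?_
    rw [mul_assoc]
    refine hG _ τ _ (by positivity) fun τ' hτ' => ?_
    rw [Pi.norm_single]
    exact hc τ' R hR (hx τ' (by omega)) p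
  have hξ : ∀ τ ≤ t, N.toFun (s.swappingError Am Bm τ) ≤ (1 + R) * g τ := by
    intro τ
    induction τ with
    | zero =>
      intro _
      rw [s.swappingError_zero]
      simpa [hg] using N.le_bound 0
    | succ τ ih =>
      intro hτ
      have h1 : ‖(s.Z Am Bm (τ + 1))ᵀ *ᵥ (s.θ (τ + 1) - s.θ τ)‖
          ≤ d * (G * c * (1 + R) * ‖s.θ (τ + 1) - s.θ τ‖) := by
        refine (pi_norm_le_iff_of_nonneg (by positivity)).2 fun i => ?_
        exact abs_sum_mul_le (fun p => hZ (τ + 1) hτ p i) fun p =>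
          norm_le_pi_norm (s.θ (τ + 1) - s.θ τ) p
      rw [s.swappingError_succ, hgs]
      refine (N.step_le _ _).trans ?_
      have h2 := mul_le_mul_of_nonneg_left (ih (by omega)) N.rate_nonneg
      have h3 := mul_le_mul_of_nonneg_left h1 hb0
      linarith
  have hε : ‖s.ε Am Bm t‖ ≤ √(K * a t) * (1 + R) := by
    have h1 : ∀ i, s.N Am Bm κ t i i ≤ K * (1 + R) ^ 2 := by
      intro i
      have h2 : ∀ q, |((s.Z Am Bm t)ᵀ * s.Pprev t) i q| ≤ d * (G * c * (1 + R) * P₀.trace) :=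
        fun q => abs_sum_mul_le (fun p => hZ t le_rfl p i)
          fun p => hs.abs_gain_le hκ hP₀ t p q
      have h3 : |((s.Z Am Bm t)ᵀ * s.Pprev t * s.Z Am Bm t) i i|
          ≤ d * (d * (G * c * (1 + R) * P₀.trace) * (G * c * (1 + R))) :=
        abs_sum_mul_le h2 fun q => hZ t le_rfl q i
      have h4 : s.N Am Bm κ t i i = κ + ((s.Z Am Bm t)ᵀ * s.Pprev t * s.Z Am Bm t) i i := by
        simp [Signals.N]
      have h5 : κ * 1 ≤ κ * (1 + R) ^ 2 :=
        mul_le_mul_of_nonneg_left (one_le_pow₀ (by linarith)) hκ.le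
      rw [h4, hK]
      linarith [le_abs_self (((s.Z Am Bm t)ᵀ * s.Pprev t * s.Z Am Bm t) i i)]
    -- Cauchy–Schwarz with `N` in the role of `P`: `ε_i² ≤ N_ii · εᵀN⁻¹ε`.
    have h2 : ‖s.ε Am Bm t‖ ≤ √(K * (1 + R) ^ 2 * a t) :=
      norm_le_sqrt_of_sq_le fun i => (sq_le_diag_mul_quadForm_inv (hN t) _ i).trans
        (mul_le_mul_of_nonneg_right (h1 i) (ha0 t))
    rwa [mul_right_comm, Real.sqrt_mul' _ (sq_nonneg _), Real.sqrt_sq h1R] at h2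
  have hex : s.ex t = s.ε Am Bm t - s.swappingError Am Bm t := by
    rw [s.ε_eq, add_sub_cancel_right]
  rw [hex]
  refine (norm_sub_le _ _).trans ?_
  have := (N.norm_le _).trans (hξ t le_rfl)
  linarith

end IsClosedLoop

end MRAC

/-! ### Boundedness of all signals and asymptotic tracking -/

theorem theorem3p1 {n m : ℕ}
    -- plant, reference model and reference input
    (A : Matrix (Fin n) (Fin n) ℝ) (B : Matrix (Fin n) (Fin m) ℝ)
    (Am : Matrix (Fin n) (Fin n) ℝ) (Bm : Matrix (Fin n) (Fin m) ℝ)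
    (r : ℕ → Fin m → ℝ)
    -- the reference model is stable and the reference input is bounded
    (hAm : MRAC.IsSchurStable Am)
    (hr : MRAC.BoundedSignal r)
    -- matching condition with a nonsingular diagonal gain diag(k)
    (K₁ : Matrix (Fin n) (Fin m) ℝ) (k : Fin m → ℝ) (hk : ∀ j, k j ≠ 0)
    (hA : A + B * K₁ᵀ = Am) (hB : B * Matrix.diagonal k = Bm)
    -- the signs of the k j, and upper bounds of |k j|, are known
    (σ : Fin m → SignType) (hσ : ∀ j, σ j = SignType.sign (k j))
    (kb : Fin m → ℝ) (hkb : ∀ j, |k j| ≤ kb j)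
    -- design choices: κ > 0, P₀ = P₀ᵀ > 0 and an admissible initial estimate
    (κ : ℝ) (hκ : 0 < κ)
    (P₀ : Matrix (MRAC.ParamIdx n m) (MRAC.ParamIdx n m) ℝ) (hP₀ : P₀.PosDef)
    (θ₀ : MRAC.ParamIdx n m → ℝ) (hθ₀ : θ₀ ∈ MRAC.admissible σ kb)
    -- any trajectory of the closed-loop system
    (s : MRAC.Signals n m)
    (hs : MRAC.IsClosedLoop A B Am Bm r σ kb κ P₀ θ₀ s) :
    -- the control law is meaningful
    (∀ t, IsUnit (s.Θ₂ t)) ∧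
    -- all closed-loop signals are bounded
    MRAC.BoundedSignal s.x ∧
    MRAC.BoundedSignal s.xm ∧
    MRAC.BoundedSignal s.xhat ∧
    MRAC.BoundedSignal s.ex ∧
    MRAC.BoundedSignal s.u ∧
    MRAC.BoundedSignal s.θ ∧
    MRAC.BoundedMatrixSignal (fun t => (s.Θ₂ t)⁻¹) ∧
    MRAC.BoundedSignal s.ω ∧
    MRAC.BoundedMatrixSignal (s.Z Am Bm) ∧
    MRAC.BoundedMatrixSignal (fun t => Matrix.of fun i j => s.ξ Am Bm i j t) ∧
    MRAC.BoundedSignal (s.ε Am Bm) ∧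
    MRAC.BoundedMatrixSignal s.Pprev ∧
    MRAC.BoundedMatrixSignal (s.N Am Bm κ) ∧
    MRAC.BoundedMatrixSignal (fun t => (s.N Am Bm κ t)⁻¹) ∧
    MRAC.BoundedSignal (s.lsUpdate Am Bm κ) ∧
    -- the tracking objective is achieved
    Tendsto (fun t => s.x t - s.xm t) atTop (𝓝 0) := by
  open MRAC in
  obtain ⟨N⟩ := hAm.nonempty_contractingNorm
  have hkb0 : ∀ j, 0 < kb j := fun j => (abs_pos.2 (hk j)).trans_le (hkb j)
  have hideal := idealParam_mem_admissible K₁ hk hσ hkb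
  have hP := hs.posDef_gain hκ hP₀
  obtain ⟨hθ, -, -⟩ := hs.adaptation N hκ hP₀ hθ₀ hkb0 hk hideal hA hB
  obtain ⟨γ, hγ, hex⟩ := hs.exists_vanishing_gain N hκ hP₀ hr hθ₀ hkb0 hk hideal hA hB
  obtain ⟨D, hD0, hD⟩ := boundedSignal_iff.1 hr
  obtain ⟨b, hb0, hb⟩ := exists_norm_mulVec_le Bm
  have hstable : ∀ y : ℕ → Fin n → ℝ, (∀ t, y (t + 1) = Am *ᵥ y t + Bm *ᵥ r t) →
      ∃ C, 0 ≤ C ∧ ∀ t, ‖y t‖ ≤ C := fun y hy => by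
    have h : ∀ t, ‖y t‖ ≤ _ := fun t => N.norm_le_of_input_le (fun τ _ => hy τ)
      (mul_nonneg hb0 hD0) (fun τ _ => (hb _).trans (mul_le_mul_of_nonneg_left (hD τ) hb0)) t le_rfl
    exact ⟨_, (norm_nonneg _).trans (h 0), h⟩
  have hxm := hstable s.xm hs.reference
  obtain ⟨H, hH0, hH⟩ := hstable s.xhat (hs.estimator_eq hθ₀ hkb0)
  have hxeq : ∀ t, s.x t = s.xhat t - s.ex t := fun t => by
    rw [Signals.ex, sub_sub_cancel]
  obtain ⟨R, hR0, hR⟩ := bounded_of_vanishing_gain (b := fun t => ‖s.x t‖) (C := H) hγ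
    fun t R hR hx => by
      rw [hxeq]
      exact (norm_sub_le _ _).trans (add_le_add (hH t) (hex t R hR hx))
  have hexlim : Tendsto s.ex atTop (𝓝 0) :=
    squeeze_zero_norm (fun t => hex t R hR0 fun τ _ => hR τ)
      (by simpa using hγ.mul_const (1 + R))
  have hexb := boundedSignal_of_tendsto_zero hexlim
  obtain ⟨c, hc0, hc⟩ := hs.exists_norm_ω_le hr hθ₀ hkb0 hθ
  have hω : ∀ t p, |s.ω t p| ≤ c * (1 + R) := fun t p => hc t R hR0 (hR t) p
  obtain ⟨G, hG0, hG⟩ := N.exists_gain Bm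
  have hentry : ∀ (v : ℕ → ℝ) (V : ℝ), 0 ≤ V → (∀ τ, |v τ| ≤ V) → ∀ i j t,
      |transferEntry Am Bm i j v t| ≤ G * V := fun v V hV hv i j t =>
    (norm_le_pi_norm (transferMatrix Am Bm _ t) i).trans
      (hG _ t V hV fun τ _ => by rw [Pi.norm_single]; exact hv τ)
  have hcR : 0 ≤ c * (1 + R) := mul_nonneg hc0 (by linarith)
  have hZ : ∀ t p i, |s.Z Am Bm t p i| ≤ G * (c * (1 + R)) := fun t p i =>
    hentry _ _ hcR (fun τ => hω τ p) i p.1 t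
  have hZb : BoundedMatrixSignal (s.Z Am Bm) := ⟨_, hZ⟩
  obtain ⟨E, hE0, hE⟩ := boundedSignal_iff.1 hθ
  have hE' : ∀ t p, |s.θ t p| ≤ E := fun t p => (norm_le_pi_norm _ p).trans (hE t)
  have hξ : ∀ t i j, |s.ξ Am Bm i j t| ≤ Fintype.card (ColIdx n) * (E * (G * (c * (1 + R))))
      + G * D := fun t i j => by
    refine (abs_sub _ _).trans (add_le_add ?_ ?_)
    · exact abs_sum_mul_le (fun l => hE' t (j, l)) fun l => hZ t (j, l) i
    -- The filtered signal `θ_jᵀ ω_j` is exactly `r_j`, so the bound on the reference suffices.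
    · refine hentry _ D hD0 (fun τ => ?_) i j t
      have := congrFun (hs.regression_self hθ₀ hkb0 τ) j
      rw [Signals.regression] at this
      rw [this]
      exact (norm_le_pi_norm _ j).trans (hD τ)
  have hε : BoundedSignal (s.ε Am Bm) := by
    obtain ⟨C, hC⟩ := hexb
    refine ⟨C + m * (Fintype.card (ColIdx n) * (E * (G * (c * (1 + R)))) + G * D), fun t i => ?_⟩
    refine (abs_add_le _ _).trans (add_le_add (hC t i) ?_)
    refine (Finset.abs_sum_le_sum_abs _ _).trans ?_
    refine (Finset.sum_le_card_nsmul _ _ _ fun j _ => hξ t i j).trans_eq ?_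
    rw [Finset.card_univ, Fintype.card_fin, nsmul_eq_mul]
  have hPb : BoundedMatrixSignal s.Pprev := ⟨_, hs.abs_gain_le hκ hP₀⟩
  have hNinv : BoundedMatrixSignal (fun t => (s.N Am Bm κ t)⁻¹) := by
    refine ⟨κ⁻¹, fun t i j => ?_⟩
    have hN := (posDef_normalizer hκ (hP t).posSemidef (s.Z Am Bm t)).inv
    refine abs_le_of_sq_le_sq ((sq_apply_le_diag_mul_diag hN i j).trans ?_) (inv_pos.2 hκ).le
    rw [sq]
    exact mul_le_mul (normalizer_inv_diag_le hκ (hP t).posSemidef _ i)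
      (normalizer_inv_diag_le hκ (hP t).posSemidef _ j) hN.posSemidef.diag_nonneg (inv_pos.2 hκ).le
  have hNb : BoundedMatrixSignal (s.N Am Bm κ) := by
    obtain ⟨C, hC⟩ := (hZb.transpose.mul hPb).mul hZb
    refine ⟨κ + C, fun t i j => (abs_add_le _ _).trans (add_le_add ?_ (hC t i j))⟩
    rw [Matrix.smul_apply, Matrix.one_apply, smul_eq_mul]
    split_ifs
    · rw [mul_one, abs_of_pos hκ]
    · rw [mul_zero, abs_zero]
      exact hκ.le
  refine ⟨hs.isUnit_Θ₂ hθ₀ hkb0, boundedSignal_iff.2 ⟨R, hR0, hR⟩, boundedSignal_iff.2 hxm,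
    boundedSignal_iff.2 ⟨H, hH0, hH⟩, hexb, ⟨_, fun t j => hω t (j, Sum.inr ())⟩, hθ,
    ⟨_, hs.abs_inv_Θ₂_le hθ₀ hkb0⟩, ⟨_, hω⟩, hZb, ⟨_, hξ⟩, hε, hPb, hNb, hNinv,
    hθ.sub (((hPb.mul hZb).mul hNinv).mulVec hε), ?_⟩
  -- Both states satisfy the same driven equation, so their difference is a free response of `A_m`.
  have hlim : Tendsto (fun t => s.xhat t - s.xm t) atTop (𝓝 0) :=
    N.tendsto_zero (f := fun _ => 0) (fun t => by
      rw [hs.estimator_eq hθ₀ hkb0, hs.reference, mulVec_sub]; abel) tendsto_const_nhds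
  have h := hlim.sub hexlim
  rw [sub_zero] at h
  refine h.congr fun t => ?_
  rw [hxeq t]
  abel
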